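/- Let $L^0(\mathbb{R}^n)$ be the space of (a.e. classes of) measurable functions $f\colon\mathbb{R}^n\to\mathbb{R}$. A Banach function space over $\mathbb{R}^n$ is an order ideal $X\subset L^0(\mathbb{R}^n)$ with a norm $\|\cdot\|_X$ such that: $\|f\|_X\le\|g\|_X$ whenever $f,g\in X$, $|f|\le|g|$; there is $f\in X$ with $f>0$ a.e.; and if $f_k\in X$, $0\le f_k\uparrow f$ and $\sup_k\|f_k\|_X<\infty$, then $f\in X$ and $\|f\|_X=\sup_k\|f_k\|_X$. Put $\|f\|_X=\infty$ for $f\in L^0(\mathbb{R}^n)\setminus X$. The associate space $X'$ consists of all $g\in L^0(\mathbb{R}^n)$ with $\|g\|_{X'}:=\sup_{\|f\|_X\le1}\int_{\mathbb{R}^n}|fg|<\infty$. Let $\langle f\rangle_Q=\frac1{|Q|}\int_Q f$ and $Mf=\sup_Q\langle|f|\rangle_Q\chi_Q$, where here and below $Q$ runs over all cubes in $\mathbb{R}^n$ with sides parallel to the axes. For measurable $f$ put $\|f\|_{X_Q}:=\|f\chi_Q\|_X/\|\chi_Q\|_X$ and, for locally integrable $f$ in the first two cases, $$\|f\|_{\mathrm{BMO}}:=\sup_Q\frac1{|Q|}\int_Q|f-\langle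 f\rangle_Q|,\qquad \|f\|_{\mathrm{BMO}_X}:=\sup_Q\|f-\langle f\rangle_Q\|_{X_Q},\qquad \|f\|_{\mathrm{BMO}_X^*}:=\sup_Q\inf_{c\in\mathbb{R}}\|f-c\|_{X_Q}.$$ Let $\mathrm{BMO}$ and $\mathrm{BMO}_X$ be the spaces of all locally integrable $f$ for which the respective quantity is finite, and $\mathrm{BMO}_X^*$ the space of all measurable $f$ with $\|f\|_{\mathrm{BMO}_X^*}<\infty$. **Proposition.** Let $X$ be a Banach function space over $\mathbb{R}^n$. Assume either of the following conditions: (i) $M$ is bounded on $X'$, i.e. there is $C\ge 0$ with $\|Mg\|_{X'}\le C\|g\|_{X'}$ for all $g\in X'$ (in particular $Mg<\infty$ a.e.); (ii) $X$ is $q$-concave for some $q\in[1,\infty)$, i.e. there is $C\ge0$ such that $\big(\sum_{k=1}^m\|f_k\|_X^q\big)^{1/q}\le C\big\|\big(\sum_{k=1}^m|f_k|^q\big)^{1/q}\big\|_X$ for all $m$ and $f_1,\dots,f_m\in X$, and $M$ is restricted weak type bounded on $X$, i.e. there is $C\ge0$ such that $\sup_{\lambda>0}\lambda\|\chi_{\{M\chi_E>\lambda\}}\|_X\le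 C\|\chi_E\|_X$ for all measurable $E\subset\mathbb{R}^n$. Then $0<\|\chi_Q\|_X<\infty$ for every cube $Q$, so that the quotients $\|\cdot\|_{X_Q}$ make sense, and $$\mathrm{BMO}=\mathrm{BMO}_X=\mathrm{BMO}_X^*$$ as sets and with equivalence of the three seminorms (with constants independent of the function). -/

import Mathlib

open MeasureTheory Set Filter Topology
open scoped ENNReal NNReal

namespace BMOSpaces

/-- Equivalence classes modulo a.e. equality of measurable functions on `ℝⁿ`. -/
abbrev L0 (n : ℕ) : Type := (Fin n → ℝ) →ₘ[volume] ℝ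

/-- A Banach function space over `ℝⁿ`: an order ideal in `L⁰(ℝⁿ)` with a norm that is compatible
with the order, has a weak order unit and has the Fatou property. (Completeness is a consequence
of the Fatou property.) -/
structure BanachFunctionSpace (n : ℕ) where
  /-- the underlying linear subspace of `L⁰(ℝⁿ)` -/
  carrier : Submodule ℝ (L0 n)
  /-- the norm -/
  nrm : Seminorm ℝ carrier
  eq_zero_of_nrm : ∀ f : carrier, nrm f = 0 → f = 0
  ideal : ∀ (f : L0 n) (g : carrier), |f| ≤ |(g : L0 n)| → f ∈ carrier
  compatible : ∀ f g : carrier, |(f : L0 n)| ≤ |(g : L0 n)| → nrm f ≤ nrm g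
  weak_order_unit : ∃ f : carrier, ∀ᵐ x ∂volume, 0 < (f : L0 n) x
  fatou : ∀ (u : ℕ → carrier) (f : L0 n), (∀ k, 0 ≤ (u k : L0 n)) →
    (∀ k, (u k : L0 n) ≤ (u (k + 1) : L0 n)) →
    (∀ᵐ x ∂volume, Tendsto (fun k => (u k : L0 n) x) atTop (𝓝 (f x))) →
    BddAbove (range fun k => nrm (u k)) →
    ∃ hf : f ∈ carrier, IsLUB (range fun k => nrm (u k)) (nrm ⟨f, hf⟩)

/-- The open cube with sides parallel to the axes, lower corner `a` and side length `l`.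
(Whether cubes are open, half-open or closed changes neither the averages nor the maximal
operator nor the a.e. classes of their indicators.) -/
def cube {n : ℕ} (a : Fin n → ℝ) (l : ℝ) : Set (Fin n → ℝ) :=
  Set.univ.pi fun i => Set.Ioo (a i) (a i + l)

/-- `𝒬`, the set of all cubes in `ℝⁿ` with sides parallel to the axes. -/
def cubes (n : ℕ) : Set (Set (Fin n → ℝ)) :=
  {Q | ∃ (a : Fin n → ℝ) (l : ℝ), 0 < l ∧ Q = cube a l}

/-- The indicator function `χ_E`. -/
noncomputable def chi {n : ℕ} (E : Set (Fin n → ℝ)) : (Fin n → ℝ) → ℝ :=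
  E.indicator fun _ => 1

/-- The Hardy-Littlewood maximal function `Mf = sup_Q ⟨|f|⟩_Q χ_Q`, with values in `[0, ∞]`. -/
noncomputable def maximal {n : ℕ} (f : (Fin n → ℝ) → ℝ) (x : Fin n → ℝ) : ℝ≥0∞ :=
  ⨆ (Q ∈ cubes n) (_ : x ∈ Q), ⨍⁻ y in Q, ‖f y‖ₑ ∂volume

namespace BanachFunctionSpace

variable {n : ℕ} (X : BanachFunctionSpace n)

/-- `‖f‖_X` for an arbitrary function `f`: the norm of the a.e. class of `f` if this class is an
element of `X`, and `∞` otherwise. -/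
noncomputable def eNrm (f : (Fin n → ℝ) → ℝ) : ℝ≥0∞ :=
  ⨅ (g : X.carrier) (_ : f =ᵐ[volume] (g : L0 n)), ENNReal.ofReal (X.nrm g)

/-- The norm of the associate space `X'`, evaluated at the absolute value `g = |h|` of a function:
`‖h‖_{X'} = sup_{‖f‖_X ≤ 1} ∫ |f h|`. A function `h` belongs to `X'` iff this is finite; since `X`
has a weak order unit, a finite value forces `g < ∞` a.e. -/
noncomputable def assocENrm (g : (Fin n → ℝ) → ℝ≥0∞) : ℝ≥0∞ :=
  ⨆ (f : X.carrier) (_ : X.nrm f ≤ 1), ∫⁻ x, ‖(f : L0 n) x‖ₑ * g x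

/-- The maximal operator is bounded on the associate space `X'`. -/
def MaximalBoundedOnAssociate : Prop :=
  ∃ C : ℝ≥0, ∀ g : L0 n, X.assocENrm (fun x => ‖g x‖ₑ) < ∞ →
    X.assocENrm (maximal g) ≤ C * X.assocENrm (fun x => ‖g x‖ₑ)

/-- `X` is `q`-concave. -/
def IsConcave (q : ℝ) : Prop :=
  ∃ C : ℝ≥0, ∀ (m : ℕ) (f : Fin m → X.carrier),
    ENNReal.ofReal ((∑ k, X.nrm (f k) ^ q) ^ (1 / q)) ≤
      C * X.eNrm fun x => (∑ k, |(f k : L0 n) x| ^ q) ^ (1 / q)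

/-- The maximal operator is restricted weak type bounded on `X`. -/
def MaximalRestrictedWeakType : Prop :=
  ∃ C : ℝ≥0, ∀ E : Set (Fin n → ℝ), MeasurableSet E → ∀ t : ℝ, 0 < t →
    ENNReal.ofReal t * X.eNrm (chi {x | ENNReal.ofReal t < maximal (chi E) x}) ≤
      C * X.eNrm (chi E)

/-- `‖f‖_{X_Q} = ‖f χ_Q‖_X / ‖χ_Q‖_X` (meaningful if `χ_Q ∈ X`). -/
noncomputable def localENrm (Q : Set (Fin n → ℝ)) (f : (Fin n → ℝ) → ℝ) : ℝ≥0∞ :=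
  X.eNrm (Q.indicator f) / X.eNrm (chi Q)

/-- `‖f‖_{BMO_X} = sup_Q ‖f - ⟨f⟩_Q‖_{X_Q}`. -/
noncomputable def bmoNrm (f : (Fin n → ℝ) → ℝ) : ℝ≥0∞ :=
  ⨆ Q ∈ cubes n, X.localENrm Q fun x => f x - ⨍ y in Q, f y ∂volume

/-- `‖f‖_{BMO_X^*} = sup_Q inf_c ‖f - c‖_{X_Q}`. -/
noncomputable def bmoStarNrm (f : (Fin n → ℝ) → ℝ) : ℝ≥0∞ :=
  ⨆ Q ∈ cubes n, ⨅ c : ℝ, X.localENrm Q fun x => f x - c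

/-- `BMO_X`. -/
def BMO : Set ((Fin n → ℝ) → ℝ) :=
  {f | LocallyIntegrable f volume ∧ X.bmoNrm f < ∞}

/-- `BMO_X^*`; no local integrability is required. -/
def BMOStar : Set ((Fin n → ℝ) → ℝ) :=
  {f | AEMeasurable f volume ∧ X.bmoStarNrm f < ∞}

end BanachFunctionSpace

/-- `‖f‖_{BMO} = sup_Q |Q|⁻¹ ∫_Q |f - ⟨f⟩_Q|`. -/
noncomputable def bmoNrm {n : ℕ} (f : (Fin n → ℝ) → ℝ) : ℝ≥0∞ :=
  ⨆ Q ∈ cubes n, ⨍⁻ x in Q, ‖f x - ⨍ y in Q, f y ∂volume‖ₑ ∂volume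

/-- The classical space `BMO` on `ℝⁿ`. -/
def BMO (n : ℕ) : Set ((Fin n → ℝ) → ℝ) :=
  {f | LocallyIntegrable f volume ∧ bmoNrm f < ∞}

end BMOSpaces

/-! The hypotheses on `X` enter only through the finiteness of `‖χ_Q‖_X` and two inequalities.
`VolumeBound` says `|E|/|Q| ≤ C ‖χ_E‖_X/‖χ_Q‖_X` for measurable `E ⊆ Q`. `SparseBound` says `‖f‖_X ≤
C ‖χ_Q‖_X` whenever `|f| ≤ ∑ χ_{Ω_k}`, where `Q = Ω_0 ⊇ Ω_1 ⊇ …` are unions of disjoint cubes and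
`Ω_{k+1}` fills at most half of each cube of `Ω_k`.

The engine is `exists_sparse_domination`: if for every cube `P` there is a number `c P` with `|f - c
P| ≤ t` outside a subset of `P` of relative volume `2^{-(n+2)}`, then `|f - c Q| ≤ 2t ∑ χ_{Ω_k}`
a.e. on `Q` for such layers. The layers come from iterating a local Calderón-Zygmund stopping
argument on the exceptional sets (`exists_stopping_cubes`).

From `BMO_X^*` to `BMO`: Chebyshev's inequality in `X` and `VolumeBound` make the exceptional sets
small for `t` comparable to the seminorm. Integrating the sparse domination gives local
integrability and the `BMO` bound (`VolumeBound.bmoNrm_le`). From `BMO` to `BMO_X`: the ordinary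
Chebyshev inequality makes the exceptional sets small, and `SparseBound` turns the domination into
an estimate in `X` (`SparseBound.bmoNrm_le`). The step from `BMO_X` to `BMO_X^*` is trivial.

Under (i) both inequalities follow by duality: the norm of `X` is recovered from `X'`
(`eNrm_le_of_forall_assoc`), and averages of `g` over cubes are at most `Mg`, whose norm in `X'` is
controlled. Under (ii), `VolumeBound` is the weak type estimate for `χ_E`. For `SparseBound`, the
same estimate compares `Ω_k` with `Ω_k \ Ω_{k+1}`, and `q`-concavity applied to many of these
disjoint differences forces `‖χ_{Ω_k}‖_X` to decay geometrically. -/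

namespace BMOSpaces

namespace BanachFunctionSpace

/-! ### The extended norm on functions and Hölder's inequality. -/

section Norm

variable {n : ℕ} (X : BanachFunctionSpace n)

theorem eNrm_eq_of_ae_eq {f : (Fin n → ℝ) → ℝ} {g : X.carrier}
    (h : f =ᵐ[volume] (g : L0 n)) : X.eNrm f = ENNReal.ofReal (X.nrm g) := by
  refine le_antisymm (iInf₂_le g h) (le_iInf₂ fun g' h' => ?_)
  have : g = g' := Subtype.ext (AEEqFun.ext (h.symm.trans h'))
  rw [this]

theorem eNrm_coe (g : X.carrier) : X.eNrm (g : L0 n) = ENNReal.ofReal (X.nrm g) :=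
  X.eNrm_eq_of_ae_eq (ae_eq_refl _)

theorem exists_of_eNrm_ne_top {f : (Fin n → ℝ) → ℝ} (h : X.eNrm f ≠ ∞) :
    ∃ g : X.carrier, f =ᵐ[volume] (g : L0 n) := by
  by_contra! hf
  exact h (iInf₂_eq_top.2 fun g hg => absurd hg (hf g))

theorem aemeasurable_of_eNrm_ne_top {f : (Fin n → ℝ) → ℝ} (h : X.eNrm f ≠ ∞) :
    AEMeasurable f volume := by
  obtain ⟨g, hg⟩ := X.exists_of_eNrm_ne_top h
  exact (AEEqFun.aemeasurable _).congr hg.symm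

theorem eNrm_congr {f g : (Fin n → ℝ) → ℝ} (h : f =ᵐ[volume] g) : X.eNrm f = X.eNrm g := by
  have key : ∀ {f g : (Fin n → ℝ) → ℝ}, f =ᵐ[volume] g → X.eNrm f ≤ X.eNrm g :=
    fun h => le_iInf₂ fun u hu => iInf₂_le u (h.trans hu)
  exact le_antisymm (key h) (key h.symm)

/-- Measurability of `f` has to be assumed, because `eNrm` is `∞` on functions without an a.e.
class. -/
theorem eNrm_mono {f g : (Fin n → ℝ) → ℝ} (hf : AEMeasurable f volume)
    (h : ∀ᵐ x ∂volume, |f x| ≤ |g x|) : X.eNrm f ≤ X.eNrm g := by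
  refine le_iInf₂ fun u hu => ?_
  have hf' : f =ᵐ[volume] AEEqFun.mk f hf.aestronglyMeasurable := (AEEqFun.coeFn_mk _ _).symm
  have hle : |AEEqFun.mk f hf.aestronglyMeasurable| ≤ |(u : L0 n)| := by
    rw [← AEEqFun.coeFn_le]
    filter_upwards [hf', hu, h, AEEqFun.coeFn_abs (AEEqFun.mk f hf.aestronglyMeasurable),
      AEEqFun.coeFn_abs (u : L0 n)] with x h1 h2 h3 h4 h5
    rw [h4, h5, ← h1, ← h2]
    exact h3
  have hmem := X.ideal _ u hle
  rw [X.eNrm_eq_of_ae_eq (g := ⟨_, hmem⟩) hf']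
  exact ENNReal.ofReal_le_ofReal (X.compatible ⟨_, hmem⟩ u hle)

theorem eNrm_zero : X.eNrm (fun _ => 0) = 0 := by
  have h : (fun _ => 0) =ᵐ[volume] ((0 : X.carrier) : L0 n) := AEEqFun.coeFn_zero.symm
  rw [X.eNrm_eq_of_ae_eq h, map_zero, ENNReal.ofReal_zero]

theorem ae_eq_zero_of_eNrm_eq_zero {f : (Fin n → ℝ) → ℝ} (h : X.eNrm f = 0) :
    f =ᵐ[volume] 0 := by
  obtain ⟨g, hg⟩ := X.exists_of_eNrm_ne_top (f := f) (by simp [h])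
  rw [X.eNrm_eq_of_ae_eq hg, ENNReal.ofReal_eq_zero] at h
  have : g = 0 := X.eq_zero_of_nrm g (le_antisymm h (apply_nonneg _ _))
  rw [this] at hg
  exact hg.trans AEEqFun.coeFn_zero

theorem eNrm_add_le (f g : (Fin n → ℝ) → ℝ) :
    X.eNrm (fun x => f x + g x) ≤ X.eNrm f + X.eNrm g := by
  rcases eq_or_ne (X.eNrm f) ∞ with hf | hf
  · simp [hf]
  rcases eq_or_ne (X.eNrm g) ∞ with hg | hg
  · simp [hg]
  obtain ⟨u, hu⟩ := X.exists_of_eNrm_ne_top hf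
  obtain ⟨v, hv⟩ := X.exists_of_eNrm_ne_top hg
  have huv : (fun x => f x + g x) =ᵐ[volume] ((u + v : X.carrier) : L0 n) :=
    (hu.add hv).trans (AEEqFun.coeFn_add _ _).symm
  rw [X.eNrm_eq_of_ae_eq hu, X.eNrm_eq_of_ae_eq hv, X.eNrm_eq_of_ae_eq huv,
    ← ENNReal.ofReal_add (apply_nonneg _ _) (apply_nonneg _ _)]
  exact ENNReal.ofReal_le_ofReal (map_add_le_add _ _ _)

theorem eNrm_const_mul {c : ℝ} (hc : c ≠ 0) (f : (Fin n → ℝ) → ℝ) :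
    X.eNrm (fun x => c * f x) = ‖c‖ₑ * X.eNrm f := by
  have key : ∀ (c : ℝ), c ≠ 0 → ∀ f : (Fin n → ℝ) → ℝ,
      X.eNrm (fun x => c * f x) ≤ ‖c‖ₑ * X.eNrm f := by
    intro c hc f
    rcases eq_or_ne (X.eNrm f) ∞ with hf | hf
    · rw [hf, ENNReal.mul_top (by simpa using hc)]
      exact le_top
    obtain ⟨u, hu⟩ := X.exists_of_eNrm_ne_top hf
    have hcu : (fun x => c * f x) =ᵐ[volume] ((c • u : X.carrier) : L0 n) :=
      (hu.const_smul c).trans (AEEqFun.coeFn_smul _ _).symm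
    rw [X.eNrm_eq_of_ae_eq hu, X.eNrm_eq_of_ae_eq hcu, map_smul_eq_mul,
      ENNReal.ofReal_mul (norm_nonneg _), ofReal_norm]
  refine le_antisymm (key c hc f) ?_
  have h := key c⁻¹ (inv_ne_zero hc) fun x => c * f x
  simp only [inv_mul_cancel_left₀ hc] at h
  calc ‖c‖ₑ * X.eNrm f ≤ ‖c‖ₑ * (‖c⁻¹‖ₑ * X.eNrm fun x => c * f x) := by gcongr
    _ = X.eNrm fun x => c * f x := by
      rw [← mul_assoc, ← enorm_mul, mul_inv_cancel₀ hc, enorm_one, one_mul]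

theorem eNrm_le_of_tendsto {u : ℕ → (Fin n → ℝ) → ℝ} {f : (Fin n → ℝ) → ℝ} {K : ℝ≥0∞}
    (hu0 : ∀ k, ∀ᵐ x ∂volume, 0 ≤ u k x) (hmono : ∀ k, ∀ᵐ x ∂volume, u k x ≤ u (k + 1) x)
    (hlim : ∀ᵐ x ∂volume, Tendsto (fun k => u k x) atTop (𝓝 (f x)))
    (hK : ∀ k, X.eNrm (u k) ≤ K) : X.eNrm f ≤ K := by
  rcases eq_or_ne K ∞ with rfl | hK'
  · exact le_top
  choose v hv using fun k => X.exists_of_eNrm_ne_top (ne_top_of_le_ne_top hK' (hK k))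
  have hvK : ∀ k, X.nrm (v k) ≤ K.toReal := fun k => by
    have := hK k
    rw [X.eNrm_eq_of_ae_eq (hv k)] at this
    exact (ENNReal.ofReal_le_iff_le_toReal hK').1 this
  have hf : AEMeasurable f volume :=
    aemeasurable_of_tendsto_metrizable_ae atTop
      (fun k => (AEEqFun.aemeasurable _).congr (hv k).symm) hlim
  have hf' : f =ᵐ[volume] AEEqFun.mk f hf.aestronglyMeasurable := (AEEqFun.coeFn_mk _ _).symm
  obtain ⟨hmem, hlub⟩ := X.fatou v (AEEqFun.mk f hf.aestronglyMeasurable)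
    (fun k => by
      rw [← AEEqFun.coeFn_le]
      filter_upwards [hv k, hu0 k, AEEqFun.coeFn_zero (α := Fin n → ℝ) (β := ℝ) (μ := volume)]
        with x h1 h2 h3
      rw [h3, ← h1]
      exact h2)
    (fun k => by
      rw [← AEEqFun.coeFn_le]
      filter_upwards [hv k, hv (k + 1), hmono k] with x h1 h2 h3
      rwa [← h1, ← h2])
    (by
      filter_upwards [ae_all_iff.2 hv, hf', hlim] with x h1 h2 h3
      simpa only [← h1, ← h2] using h3)
    ⟨K.toReal, by rintro _ ⟨k, rfl⟩; exact hvK k⟩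
  rw [X.eNrm_eq_of_ae_eq (g := ⟨_, hmem⟩) hf']
  refine ENNReal.ofReal_le_of_le_toReal (hlub.2 ?_)
  rintro _ ⟨k, rfl⟩
  exact hvK k

theorem exists_order_unit : ∃ u : (Fin n → ℝ) → ℝ, Measurable u ∧ (∀ x, 0 ≤ u x) ∧
    (∀ᵐ x ∂volume, 0 < u x) ∧ X.eNrm u ≠ ∞ := by
  obtain ⟨f, hf⟩ := X.weak_order_unit
  have hm : AEMeasurable (f : L0 n) (volume : Measure (Fin n → ℝ)) := AEEqFun.aemeasurable _
  refine ⟨fun x => |hm.mk _ x|, hm.measurable_mk.abs, fun x => abs_nonneg _, ?_, ?_⟩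
  · filter_upwards [hf, hm.ae_eq_mk] with x h1 h2
    simp only [← h2]
    exact abs_pos.2 h1.ne'
  · refine ne_top_of_le_ne_top (b := X.eNrm (f : L0 n)) ?_ (X.eNrm_mono
      hm.measurable_mk.abs.aemeasurable ?_)
    · rw [X.eNrm_coe]
      exact ENNReal.ofReal_ne_top
    · filter_upwards [hm.ae_eq_mk] with x h
      rw [abs_abs, ← h]

/-- Hölder's inequality for `X` and its associate space. -/
theorem lintegral_mul_le {f : (Fin n → ℝ) → ℝ} (hf : X.eNrm f ≠ ∞)
    (g : (Fin n → ℝ) → ℝ≥0∞) : ∫⁻ x, ‖f x‖ₑ * g x ≤ X.eNrm f * X.assocENrm g := by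
  obtain ⟨u, hu⟩ := X.exists_of_eNrm_ne_top hf
  have hfu : ∫⁻ x, ‖f x‖ₑ * g x = ∫⁻ x, ‖(u : L0 n) x‖ₑ * g x := by
    refine lintegral_congr_ae ?_
    filter_upwards [hu] with x h
    rw [h]
  -- An element of norm zero cannot be normalised, but it vanishes a.e.
  rcases eq_or_ne (X.nrm u) 0 with h0 | h0
  · have h0' : X.eNrm f = 0 := by rw [X.eNrm_eq_of_ae_eq hu, h0, ENNReal.ofReal_zero]
    have : ∫⁻ x, ‖f x‖ₑ * g x = ∫⁻ _ : Fin n → ℝ, 0 := by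
      refine lintegral_congr_ae ?_
      filter_upwards [X.ae_eq_zero_of_eNrm_eq_zero h0'] with x h
      simp [h]
    rw [this, lintegral_zero]
    exact zero_le
  have hpos : 0 < X.nrm u := lt_of_le_of_ne (apply_nonneg _ _) h0.symm
  have h1 : X.nrm ((X.nrm u)⁻¹ • u) ≤ 1 := by
    rw [map_smul_eq_mul, norm_inv, Real.norm_of_nonneg hpos.le, inv_mul_cancel₀ h0]
  have h2 : ∫⁻ x, ‖(((X.nrm u)⁻¹ • u : X.carrier) : L0 n) x‖ₑ * g x ≤ X.assocENrm g :=
    le_iSup₂ (f := fun (f : X.carrier) (_ : X.nrm f ≤ 1) => ∫⁻ x, ‖(f : L0 n) x‖ₑ * g x) _ h1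
  have h3 : ∫⁻ x, ‖(((X.nrm u)⁻¹ • u : X.carrier) : L0 n) x‖ₑ * g x
      = ‖(X.nrm u)⁻¹‖ₑ * ∫⁻ x, ‖(u : L0 n) x‖ₑ * g x := by
    rw [← lintegral_const_mul' _ _ enorm_ne_top]
    refine lintegral_congr_ae ?_
    filter_upwards [AEEqFun.coeFn_smul (X.nrm u)⁻¹ (u : L0 n)] with x h
    have h' : (((X.nrm u)⁻¹ • u : X.carrier) : L0 n) x = (X.nrm u)⁻¹ * (u : L0 n) x := h
    rw [h', enorm_mul, mul_assoc]
  rw [h3] at h2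
  rw [hfu, X.eNrm_eq_of_ae_eq hu]
  have h4 : ENNReal.ofReal (X.nrm u) * ‖(X.nrm u)⁻¹‖ₑ = 1 := by
    rw [Real.enorm_eq_ofReal (inv_nonneg.2 hpos.le), ← ENNReal.ofReal_mul hpos.le,
      mul_inv_cancel₀ h0, ENNReal.ofReal_one]
  calc ∫⁻ x, ‖(u : L0 n) x‖ₑ * g x
      = ENNReal.ofReal (X.nrm u) * (‖(X.nrm u)⁻¹‖ₑ * ∫⁻ x, ‖(u : L0 n) x‖ₑ * g x) := by
        rw [← mul_assoc, h4, one_mul]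
    _ ≤ _ := by gcongr

theorem assocENrm_le {g : (Fin n → ℝ) → ℝ≥0∞} {K : ℝ≥0∞}
    (h : ∀ f : (Fin n → ℝ) → ℝ, X.eNrm f ≤ 1 → ∫⁻ x, ‖f x‖ₑ * g x ≤ K) :
    X.assocENrm g ≤ K := by
  refine iSup₂_le fun f hf => h f ?_
  rw [X.eNrm_coe]
  exact ENNReal.ofReal_le_one.2 hf

end Norm

end BanachFunctionSpace

end BMOSpaces

/-! ### Duality: recovering the norm of `X` from the associate space. -/

namespace BMOSpaces

/-- Truncation of a function in height and to a ball. -/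
noncomputable def truncate {n : ℕ} (k : ℕ) (φ : (Fin n → ℝ) → ℝ) : (Fin n → ℝ) → ℝ :=
  (Metric.closedBall 0 k).indicator fun x => min (φ x) k

section Truncate

variable {n : ℕ} {φ : (Fin n → ℝ) → ℝ}

theorem truncate_nonneg (k : ℕ) {x : Fin n → ℝ} (h : 0 ≤ φ x) : 0 ≤ truncate k φ x := by
  unfold truncate
  by_cases hx : x ∈ Metric.closedBall 0 (k : ℝ)
  · rw [indicator_of_mem hx]
    exact le_min h (Nat.cast_nonneg _)
  · rw [indicator_of_notMem hx]

theorem truncate_le (k : ℕ) {x : Fin n → ℝ} (h : 0 ≤ φ x) : truncate k φ x ≤ φ x := by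
  unfold truncate
  by_cases hx : x ∈ Metric.closedBall 0 (k : ℝ)
  · rw [indicator_of_mem hx]
    exact min_le_left _ _
  · rwa [indicator_of_notMem hx]

theorem truncate_mono {ψ : (Fin n → ℝ) → ℝ} {j k : ℕ} (hjk : j ≤ k) {x : Fin n → ℝ}
    (h0 : 0 ≤ φ x) (h : φ x ≤ ψ x) : truncate j φ x ≤ truncate k ψ x := by
  have hc : (j : ℝ) ≤ k := Nat.cast_le.2 hjk
  by_cases hx : x ∈ Metric.closedBall 0 (j : ℝ)
  · have hx' := Metric.closedBall_subset_closedBall hc hx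
    unfold truncate
    rw [indicator_of_mem hx, indicator_of_mem hx']
    exact min_le_min h hc
  · have : truncate j φ x = 0 := indicator_of_notMem hx _
    rw [this]
    exact truncate_nonneg k (h0.trans h)

theorem truncate_eventually_eq (φ : (Fin n → ℝ) → ℝ) (x : Fin n → ℝ) :
    ∀ᶠ k : ℕ in atTop, truncate k φ x = φ x := by
  obtain ⟨N, hN⟩ := exists_nat_ge (max (φ x) ‖x‖)
  filter_upwards [eventually_ge_atTop N] with k hk
  have hk' : (N : ℝ) ≤ k := Nat.cast_le.2 hk
  unfold truncate
  rw [indicator_of_mem, min_eq_left]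
  · exact (le_max_left _ _).trans (hN.trans hk')
  · simpa using (le_max_right _ _).trans (hN.trans hk')

theorem truncate_memLp (k : ℕ) (hφ : AEMeasurable φ volume) (h0 : ∀ x, 0 ≤ φ x) :
    MemLp (truncate k φ) 2 volume := by
  unfold truncate
  rw [memLp_indicator_iff_restrict Metric.isClosed_closedBall.measurableSet]
  have : IsFiniteMeasure ((volume : Measure (Fin n → ℝ)).restrict
      (Metric.closedBall 0 (k : ℝ))) :=
    ⟨by rw [Measure.restrict_apply_univ]; exact measure_closedBall_lt_top⟩
  refine MemLp.of_bound (hφ.min aemeasurable_const).aestronglyMeasurable.restrict k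
    (Eventually.of_forall fun x => ?_)
  rw [Real.norm_of_nonneg (le_min (h0 x) (Nat.cast_nonneg _))]
  exact min_le_right _ _

end Truncate

namespace BanachFunctionSpace

variable {n : ℕ} (X : BanachFunctionSpace n)

/-- An `L²` limit is an a.e. limit along a subsequence, and the Fatou property then bounds its norm.
This puts balls of `X`, cut down to `L²`, within reach of Hahn-Banach separation in a Hilbert space.
-/
theorem isClosed_eNrm_le (K : ℝ≥0∞) :
    IsClosed {h : Lp ℝ 2 (volume : Measure (Fin n → ℝ)) | X.eNrm h ≤ K} := by
  refine IsSeqClosed.isClosed fun u h hu hlim => ?_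
  obtain ⟨ns, -, hns⟩ := (tendstoInMeasure_of_tendsto_Lp hlim).exists_seq_tendsto_ae
  -- Tail infima turn a.e. convergence into monotone convergence, as the Fatou property requires.
  set w : ℕ → (Fin n → ℝ) → ℝ := fun k x => ⨅ j, |u (ns (j + k)) x| with hw
  have hbdd : ∀ k x, BddBelow (range fun j => |u (ns (j + k)) x|) := fun k x =>
    ⟨0, by rintro _ ⟨j, rfl⟩; exact abs_nonneg _⟩
  have hw0 : ∀ k x, 0 ≤ w k x := fun k x => le_ciInf fun j => abs_nonneg _
  have hwle : ∀ k x, w k x ≤ |u (ns k) x| := fun k x => by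
    simpa using ciInf_le (hbdd k x) 0
  have hwm : ∀ k, AEMeasurable (w k) volume := fun k =>
    AEMeasurable.iInf fun j => (Lp.aestronglyMeasurable _).aemeasurable.abs
  have hlimw : ∀ᵐ x ∂volume, Tendsto (fun k => w k x) atTop (𝓝 |h x|) := by
    filter_upwards [hns] with x hx
    have hx' := hx.abs
    refine tendsto_order.2 ⟨fun a ha => ?_, fun a ha => ?_⟩
    · obtain ⟨b, hab, hb⟩ := exists_between ha
      obtain ⟨N, hN⟩ := eventually_atTop.1 ((tendsto_order.1 hx').1 b hb)
      filter_upwards [eventually_ge_atTop N] with k hk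
      exact hab.trans_le (le_ciInf fun j => (hN (j + k) (by omega)).le)
    · filter_upwards [(tendsto_order.1 hx').2 a ha] with k hk
      exact (hwle k x).trans_lt hk
  have : X.eNrm (fun x => |h x|) ≤ K := by
    refine X.eNrm_le_of_tendsto (u := w) (fun k => Eventually.of_forall (hw0 k))
      (fun k => Eventually.of_forall fun x => ?_) hlimw fun k => ?_
    · refine le_ciInf fun j => ?_
      have := ciInf_le (hbdd k x) (j + 1)
      rwa [show j + 1 + k = j + (k + 1) by omega] at this
    · refine le_trans (X.eNrm_mono (hwm k) (Eventually.of_forall fun x => ?_)) (hu (ns k))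
      rw [abs_of_nonneg (hw0 k x)]
      exact hwle k x
  refine le_trans (X.eNrm_mono (Lp.aestronglyMeasurable _).aemeasurable
    (Eventually.of_forall fun x => ?_)) this
  rw [abs_abs]

theorem convex_eNrm_le (K : ℝ≥0∞) :
    Convex ℝ {h : Lp ℝ 2 (volume : Measure (Fin n → ℝ)) | X.eNrm h ≤ K} := by
  have key : ∀ (c : ℝ) (h : Lp ℝ 2 (volume : Measure (Fin n → ℝ))), 0 ≤ c → X.eNrm h ≤ K →
      X.eNrm (fun x => c * h x) ≤ ENNReal.ofReal c * K := by
    intro c h hc hh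
    rcases eq_or_ne c 0 with rfl | hc0
    · simp only [zero_mul, X.eNrm_zero]
      exact zero_le
    · rw [X.eNrm_const_mul hc0, Real.enorm_eq_ofReal hc]
      gcongr
  intro h hh g hg a b ha hb hab
  have : (a • h + b • g : Lp ℝ 2 (volume : Measure (Fin n → ℝ)))
      =ᵐ[volume] fun x => a * h x + b * g x := by
    filter_upwards [Lp.coeFn_add (a • h) (b • g), Lp.coeFn_smul a h, Lp.coeFn_smul b g]
      with x h1 h2 h3
    rw [h1, Pi.add_apply, h2, h3]
    rfl
  rw [mem_ofPred_eq, X.eNrm_congr this]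
  calc _ ≤ _ := X.eNrm_add_le _ _
    _ ≤ ENNReal.ofReal a * K + ENNReal.ofReal b * K := add_le_add (key a h ha hh) (key b g hb hg)
    _ = K := by rw [← add_mul, ← ENNReal.ofReal_add ha hb, hab, ENNReal.ofReal_one, one_mul]

/-- Hahn-Banach separates `v` from the closed convex set `B` of `L²` functions of norm at most `K`,
and Riesz represents the separating functional by some `g` in `L²` with separating level `s`.
Testing it on elements of `B` carrying the sign of `g` gives `K ∫ |f g| ≤ s` on the unit ball of
`X`, so `(K/s) g` is the required function. -/
theorem exists_assoc_of_lt_eNrm {v : (Fin n → ℝ) → ℝ} (hv : MemLp v 2 volume) {K : ℝ}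
    (hK : 0 < K) (h : ENNReal.ofReal K < X.eNrm v) :
    ∃ g : L0 n, X.assocENrm (fun x => ‖g x‖ₑ) ≤ 1 ∧
      ENNReal.ofReal K < ∫⁻ x, ‖v x‖ₑ * ‖g x‖ₑ := by
  set B := {h : Lp ℝ 2 (volume : Measure (Fin n → ℝ)) | X.eNrm h ≤ ENNReal.ofReal K}
  have hvB : hv.toLp v ∉ B := by
    rw [mem_ofPred_eq, X.eNrm_congr hv.coeFn_toLp]
    exact h.not_ge
  obtain ⟨φ, s, hφB, hφv⟩ :=
    geometric_hahn_banach_closed_point (X.convex_eNrm_le _) (X.isClosed_eNrm_le _) hvB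
  set g := (InnerProductSpace.toDual ℝ (Lp ℝ 2 (volume : Measure (Fin n → ℝ)))).symm φ with hg
  have hφg : ∀ {w : (Fin n → ℝ) → ℝ} (hw : MemLp w 2 volume),
      φ (hw.toLp w) = ∫ x, w x * g x := by
    intro w hw
    rw [← InnerProductSpace.toDual_symm_apply, L2.inner_def]
    refine integral_congr_ae ?_
    filter_upwards [hw.coeFn_toLp] with x hx
    rw [hx]
    rfl
  have hs : 0 < s := by
    have := hφB 0 (by
      rw [mem_ofPred_eq, X.eNrm_congr (Lp.coeFn_zero ℝ 2 volume)]
      exact X.eNrm_zero.trans_le zero_le)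
    rwa [map_zero] at this
  have hgm : AEMeasurable g (volume : Measure (Fin n → ℝ)) :=
    (Lp.aestronglyMeasurable _).aemeasurable
  have hint : ∀ {w : (Fin n → ℝ) → ℝ}, MemLp w 2 volume →
      Integrable (fun x => w x * g x) volume := fun hw =>
    hw.integrable_mul (Lp.memLp g)
  have hball : ∀ f : (Fin n → ℝ) → ℝ, X.eNrm f ≤ 1 →
      ENNReal.ofReal K * ∫⁻ x, ‖f x‖ₑ * ‖g x‖ₑ ≤ ENNReal.ofReal s := by
    intro f hf
    have hfm := X.aemeasurable_of_eNrm_ne_top (ne_top_of_le_ne_top ENNReal.one_ne_top hf)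
    have htm := fun k => truncate_memLp k hfm.abs fun x => abs_nonneg (f x)
    have ht0 : ∀ k x, 0 ≤ truncate k (fun x => |f x|) x := fun k x =>
      truncate_nonneg k (abs_nonneg (f x))
    -- Elements of `X` need not lie in `L²`, so the test uses truncations and then monotone
    -- convergence.
    have hk : ∀ k, ENNReal.ofReal K * ∫⁻ x, ‖truncate k (fun x => |f x|) x‖ₑ * ‖g x‖ₑ
        ≤ ENNReal.ofReal s := by
      intro k
      set t := truncate k fun x => |f x| with ht
      have hwabs : ∀ x, |K * (t x * SignType.sign (g x))| ≤ |K * t x| := fun x => by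
        rw [abs_mul, abs_mul, abs_mul]
        refine mul_le_mul_of_nonneg_left (mul_le_of_le_one_right (abs_nonneg _) ?_) (abs_nonneg _)
        rcases lt_trichotomy (g x) 0 with h | h | h <;> simp [h]
      have hsm : AEMeasurable (fun x => ((SignType.sign (g x) : SignType) : ℝ))
          (volume : Measure (Fin n → ℝ)) := by
        have : Measurable fun r : ℝ => ((SignType.sign r : SignType) : ℝ) := by
          have : (fun r : ℝ => ((SignType.sign r : SignType) : ℝ)) =
            fun r => if 0 < r then 1 else if r < 0 then -1 else 0 := by
            funext r
            rcases lt_trichotomy r 0 with h | h | h <;> simp [h, h.le, not_lt.2]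
          rw [this]
          exact Measurable.ite measurableSet_Ioi measurable_const
            (Measurable.ite measurableSet_Iio measurable_const measurable_const)
        exact this.comp_aemeasurable hgm
      have hwm : AEMeasurable (fun x => K * (t x * SignType.sign (g x))) volume :=
        ((htm k).aestronglyMeasurable.aemeasurable.mul hsm).const_mul K
      have hw : MemLp (fun x => K * (t x * SignType.sign (g x))) 2 volume :=
        ((htm k).const_mul K).mono hwm.aestronglyMeasurable (Eventually.of_forall hwabs)
      have hwB : hw.toLp _ ∈ B := by
        rw [mem_ofPred_eq, X.eNrm_congr hw.coeFn_toLp]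
        calc _ ≤ X.eNrm fun x => K * f x := X.eNrm_mono hwm (Eventually.of_forall fun x => by
              refine (hwabs x).trans ?_
              rw [abs_mul, abs_mul, abs_of_nonneg (ht0 k x)]
              exact mul_le_mul_of_nonneg_left (truncate_le k (abs_nonneg (f x))) (abs_nonneg K))
          _ = ENNReal.ofReal K * X.eNrm f := by
              rw [X.eNrm_const_mul hK.ne', Real.enorm_eq_ofReal hK.le]
          _ ≤ ENNReal.ofReal K := mul_le_of_le_one_right' hf
      have hlt := hφB _ hwB
      rw [hφg hw] at hlt
      have heq : ∀ x, K * (t x * SignType.sign (g x)) * g x = K * (t x * |g x|) := fun x => by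
        rw [mul_assoc, mul_assoc, sign_mul_self]
      simp only [heq, integral_const_mul] at hlt
      have hi : Integrable (fun x => t x * |g x|) volume := by
        refine ((hint (htm k)).abs).congr (Eventually.of_forall fun x => ?_)
        dsimp only
        rw [abs_mul, abs_of_nonneg (ht0 k x)]
      have hl : ∫⁻ x, ‖t x‖ₑ * ‖g x‖ₑ = ENNReal.ofReal (∫ x, t x * |g x|) := by
        rw [ofReal_integral_eq_lintegral_ofReal hi
          (Eventually.of_forall fun x => mul_nonneg (ht0 k x) (abs_nonneg _))]
        refine lintegral_congr fun x => ?_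
        rw [ENNReal.ofReal_mul (ht0 k x), ← Real.enorm_eq_ofReal (ht0 k x), ← Real.enorm_abs (g x),
          Real.enorm_eq_ofReal (abs_nonneg _)]
      rw [hl, ← ENNReal.ofReal_mul hK.le]
      exact ENNReal.ofReal_le_ofReal hlt.le
    rw [← lintegral_const_mul' _ _ ENNReal.ofReal_ne_top]
    simp only [← lintegral_const_mul' _ _ (ENNReal.ofReal_ne_top (r := K))] at hk
    refine le_of_tendsto' (lintegral_tendsto_of_tendsto_of_monotone
      (fun k => (((htm k).aestronglyMeasurable.aemeasurable.enorm.mul hgm.enorm).const_mul _))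
      (Eventually.of_forall fun x i j hij => ?_) (Eventually.of_forall fun x => ?_)) hk
    · have := truncate_mono (φ := fun x => |f x|) (ψ := fun x => |f x|) hij (abs_nonneg (f x))
        le_rfl
      simp only [Pi.mul_apply]
      rw [Real.enorm_eq_ofReal (ht0 i x), Real.enorm_eq_ofReal (ht0 j x)]
      gcongr
    · refine tendsto_const_nhds.congr' ?_
      filter_upwards [truncate_eventually_eq (fun x => |f x|) x] with k hk
      rw [Pi.mul_apply, hk, Real.enorm_abs]
  have hcs : ∀ w : (Fin n → ℝ) → ℝ,
      ∫⁻ x, ‖w x‖ₑ * ‖((K / s) • (g : L0 n) : L0 n) x‖ₑ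
        = ENNReal.ofReal (K / s) * ∫⁻ x, ‖w x‖ₑ * ‖g x‖ₑ := by
    intro w
    rw [← lintegral_const_mul' _ _ ENNReal.ofReal_ne_top]
    refine lintegral_congr_ae ?_
    filter_upwards [AEEqFun.coeFn_smul (K / s) (g : L0 n)] with x hx
    rw [hx, Pi.smul_apply, smul_eq_mul, enorm_mul, Real.enorm_eq_ofReal (div_pos hK hs).le]
    ring
  refine ⟨(K / s) • (g : L0 n), X.assocENrm_le fun f hf => ?_, ?_⟩
  · rw [hcs, div_eq_inv_mul, ENNReal.ofReal_mul (inv_pos.2 hs).le, mul_assoc]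
    calc _ ≤ ENNReal.ofReal s⁻¹ * ENNReal.ofReal s := by gcongr; exact hball f hf
      _ = 1 := by
        rw [← ENNReal.ofReal_mul (inv_pos.2 hs).le, inv_mul_cancel₀ hs.ne', ENNReal.ofReal_one]
  · rw [hcs]
    have h1 : ENNReal.ofReal s < ∫⁻ x, ‖v x‖ₑ * ‖g x‖ₑ := by
      calc ENNReal.ofReal s < ENNReal.ofReal (∫ x, v x * g x) := by
            rw [← hφg hv]
            exact (ENNReal.ofReal_lt_ofReal_iff (hs.trans hφv)).2 hφv
        _ ≤ ‖∫ x, v x * g x‖ₑ := by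
            rw [← ofReal_norm]
            exact ENNReal.ofReal_le_ofReal (Real.le_norm_self _)
        _ ≤ ∫⁻ x, ‖v x * g x‖ₑ := enorm_integral_le_lintegral_enorm _
        _ = _ := by simp only [enorm_mul]
    calc ENNReal.ofReal K = ENNReal.ofReal (K / s) * ENNReal.ofReal s := by
          rw [← ENNReal.ofReal_mul (div_pos hK hs).le, div_mul_cancel₀ _ hs.ne']
      _ < _ := by
          refine (ENNReal.mul_lt_mul_iff_right ?_ ENNReal.ofReal_ne_top).2 h1
          simpa using div_pos hK hs

/-- The Lorentz-Luxemburg theorem: the norm of `X` is determined by the associate space. -/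
theorem eNrm_le_of_forall_assoc {f : (Fin n → ℝ) → ℝ} (hf : AEMeasurable f volume) {K : ℝ≥0∞}
    (h : ∀ g : L0 n, X.assocENrm (fun x => ‖g x‖ₑ) ≤ 1 → ∫⁻ x, ‖f x‖ₑ * ‖g x‖ₑ ≤ K) :
    X.eNrm f ≤ K := by
  -- Passing to `L > K` makes the level strictly positive, as the separation lemma needs.
  refine le_of_forall_gt_imp_ge_of_dense fun L hL => ?_
  rcases eq_or_ne L ∞ with rfl | hL'
  · exact le_top
  lift L to ℝ≥0 using hL'
  have hL0 : (0 : ℝ) < L := by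
    have := zero_le.trans_lt hL
    exact_mod_cast this
  obtain ⟨u, hum, hu0, hupos, hu⟩ := X.exists_order_unit
  set w : ℕ → (Fin n → ℝ) → ℝ := fun k x => min |f x| (k * u x) with hw
  have hw0 : ∀ k x, 0 ≤ w k x := fun k x =>
    le_min (abs_nonneg _) (mul_nonneg (Nat.cast_nonneg _) (hu0 x))
  have hwm : ∀ k, AEMeasurable (w k) volume := fun k =>
    hf.abs.min (hum.aemeasurable.const_mul _)
  have ht0 : ∀ k x, 0 ≤ truncate k (w k) x := fun k x => truncate_nonneg k (hw0 k x)
  have htL : ∀ k, X.eNrm (truncate k (w k)) ≤ L := by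
    intro k
    by_contra! hlt
    rw [← ENNReal.ofReal_coe_nnreal] at hlt
    obtain ⟨g, hg1, hg⟩ := X.exists_assoc_of_lt_eNrm (truncate_memLp k (hwm k) (hw0 k)) hL0 hlt
    refine absurd (hg.trans_le ((lintegral_mono fun x => ?_).trans (h g hg1))) ?_
    · gcongr
      rw [← Real.enorm_abs (f x), Real.enorm_eq_ofReal (ht0 k x),
        Real.enorm_eq_ofReal (abs_nonneg _)]
      refine ENNReal.ofReal_le_ofReal ?_
      exact (truncate_le k (hw0 k x)).trans (min_le_left _ _)
    · rw [ENNReal.ofReal_coe_nnreal]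
      exact hL.not_gt
  have habs : X.eNrm (fun x => |f x|) ≤ L := by
    refine X.eNrm_le_of_tendsto (u := fun k => truncate k (w k))
      (fun k => Eventually.of_forall (ht0 k)) (fun k => Eventually.of_forall fun x => ?_) ?_ htL
    · refine truncate_mono (Nat.le_succ k) (hw0 k x) (min_le_min le_rfl ?_)
      gcongr
      · exact hu0 x
      · exact Nat.le_succ k
    · filter_upwards [hupos] with x hx
      refine tendsto_const_nhds.congr' ?_
      obtain ⟨N, hN⟩ := exists_nat_ge (max (|f x| / u x) (max |f x| ‖x‖))
      filter_upwards [eventually_ge_atTop N] with k hk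
      have hk' : (N : ℝ) ≤ k := Nat.cast_le.2 hk
      have h1 : |f x| ≤ k * u x :=
        (div_le_iff₀ hx).1 ((le_max_left _ _).trans (hN.trans hk'))
      have h2 : w k x = |f x| := min_eq_left h1
      unfold truncate
      rw [indicator_of_mem, h2, min_eq_left]
      · exact ((le_max_left _ _).trans (le_max_right _ _)).trans (hN.trans hk')
      · simpa using ((le_max_right _ _).trans (le_max_right _ _)).trans (hN.trans hk')
  refine (X.eNrm_mono hf (Eventually.of_forall fun x => ?_)).trans habs
  rw [abs_abs]

end BanachFunctionSpace

end BMOSpaces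

/-! ### Cubes, the dyadic grid of a cube, and Lebesgue density along it. -/

namespace BMOSpaces

section Cubes

variable {n : ℕ}

theorem isOpen_cube (a : Fin n → ℝ) (l : ℝ) : IsOpen (cube a l) :=
  isOpen_set_pi finite_univ fun _ _ => isOpen_Ioo

theorem measurableSet_of_mem_cubes {Q : Set (Fin n → ℝ)} (hQ : Q ∈ cubes n) :
    MeasurableSet Q := by
  obtain ⟨a, l, -, rfl⟩ := hQ
  exact (isOpen_cube a l).measurableSet

theorem volume_cube (a : Fin n → ℝ) (l : ℝ) : volume (cube a l) = ENNReal.ofReal l ^ n := by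
  simp [cube, Real.volume_pi_Ioo]

theorem volume_ne_zero_of_mem_cubes {Q : Set (Fin n → ℝ)} (hQ : Q ∈ cubes n) :
    volume Q ≠ 0 := by
  obtain ⟨a, l, hl, rfl⟩ := hQ
  rw [volume_cube]
  exact pow_ne_zero _ (by simpa using hl)

theorem volume_ne_top_of_mem_cubes {Q : Set (Fin n → ℝ)} (hQ : Q ∈ cubes n) :
    volume Q ≠ ∞ := by
  obtain ⟨a, l, -, rfl⟩ := hQ
  rw [volume_cube]
  exact ENNReal.pow_ne_top ENNReal.ofReal_ne_top

/-- Cells of the dyadic grid generated by `cube a l`. -/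
def dyadicCube (a : Fin n → ℝ) (l : ℝ) (k : ℕ) (m : Fin n → ℤ) : Set (Fin n → ℝ) :=
  cube (fun i => a i + m i * (l / 2 ^ k)) (l / 2 ^ k)

/-- The index of the cell of generation `k` that contains a given point. -/
noncomputable def dyadicIndex (a : Fin n → ℝ) (l : ℝ) (k : ℕ) (x : Fin n → ℝ) : Fin n → ℤ :=
  fun i => ⌊(x i - a i) / (l / 2 ^ k)⌋

variable {a : Fin n → ℝ} {l : ℝ}

theorem dyadicCube_mem_cubes (hl : 0 < l) (k : ℕ) (m : Fin n → ℤ) :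
    dyadicCube a l k m ∈ cubes n := ⟨_, _, by positivity, rfl⟩

theorem dyadicCube_zero : dyadicCube a l 0 0 = cube a l := by simp [dyadicCube]

theorem dyadicIndex_eq (hl : 0 < l) {k : ℕ} {m : Fin n → ℤ} {x : Fin n → ℝ}
    (hx : x ∈ dyadicCube a l k m) : dyadicIndex a l k x = m := by
  have hh : 0 < l / 2 ^ k := by positivity
  funext i
  obtain ⟨h1, h2⟩ := hx i (mem_univ i)
  refine Int.floor_eq_iff.2 ⟨?_, ?_⟩
  · rw [le_div_iff₀ hh]
    linarith
  · rw [div_lt_iff₀ hh]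
    linarith

/-- Going up `d` generations is floor division of the index by `2 ^ d`. -/
theorem dyadicIndex_div (k d : ℕ) (x : Fin n → ℝ) :
    dyadicIndex a l k x = fun i => dyadicIndex a l (k + d) x i / 2 ^ d := by
  funext i
  have := Int.floor_div_natCast ((x i - a i) / (l / 2 ^ (k + d))) (2 ^ d)
  push_cast at this
  rw [dyadicIndex, dyadicIndex, ← this]
  congr 1
  rw [pow_add]
  field_simp

theorem dyadicCube_subset (hl : 0 < l) (k d : ℕ) (m : Fin n → ℤ) :
    dyadicCube a l (k + d) m ⊆ dyadicCube a l k fun i => m i / 2 ^ d := by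
  intro x hx i _
  obtain ⟨h1, h2⟩ := hx i (mem_univ i)
  set h := l / 2 ^ (k + d) with hh
  have hpos : 0 < h := by positivity
  have hH : l / 2 ^ k = 2 ^ d * h := by
    rw [hh, pow_add]
    field_simp
  have e1 : m i / 2 ^ d * 2 ^ d ≤ m i := Int.ediv_mul_le _ (by positivity)
  have e2 : m i + 1 ≤ (m i / 2 ^ d + 1) * 2 ^ d :=
    Int.lt_ediv_add_one_mul_self _ (by positivity)
  have e1' : ((m i / 2 ^ d : ℤ) : ℝ) * 2 ^ d ≤ m i := by exact_mod_cast e1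
  have e2' : (m i : ℝ) + 1 ≤ (((m i / 2 ^ d : ℤ) : ℝ) + 1) * 2 ^ d := by exact_mod_cast e2
  have f1 := mul_le_mul_of_nonneg_right e1' hpos.le
  have f2 := mul_le_mul_of_nonneg_right e2' hpos.le
  rw [hH]
  constructor
  · linarith
  · linarith

theorem volume_dyadicCube_succ (hl : 0 < l) (k : ℕ) (m m' : Fin n → ℤ) :
    volume (dyadicCube a l k m) = 2 ^ n * volume (dyadicCube a l (k + 1) m') := by
  rw [dyadicCube, dyadicCube, volume_cube, volume_cube, ← mul_pow]
  congr 1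
  rw [show (2 : ℝ≥0∞) = ENNReal.ofReal 2 by simp, ← ENNReal.ofReal_mul (by norm_num), pow_succ]
  congr 1
  field_simp

/-- The cells are open, so only the countably many grid hyperplanes are missed. -/
theorem ae_mem_dyadicCube (hl : 0 < l) :
    ∀ᵐ x ∂(volume : Measure (Fin n → ℝ)), ∀ k, x ∈ dyadicCube a l k (dyadicIndex a l k x) := by
  have h : ∀ᵐ x ∂(volume : Measure (Fin n → ℝ)), ∀ (k : ℕ) (i : Fin n) (z : ℤ),
      x i ≠ a i + z * (l / 2 ^ k) := by
    simp_rw [ae_all_iff]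
    intro k i z
    exact Measure.ae_eval_ne _ i _
  filter_upwards [h] with x hx k i _
  have hh : 0 < l / 2 ^ k := by positivity
  have h1 := Int.floor_le ((x i - a i) / (l / 2 ^ k))
  have h2 := Int.lt_floor_add_one ((x i - a i) / (l / 2 ^ k))
  rw [le_div_iff₀ hh] at h1
  rw [div_lt_iff₀ hh] at h2
  refine ⟨lt_of_le_of_ne ?_ (hx k i _).symm, ?_⟩
  · simp only [dyadicIndex]
    linarith
  · simp only [dyadicIndex]
    linarith

theorem cube_ae_eq_closedBall (a : Fin n → ℝ) {l : ℝ} (hl : 0 < l) :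
    cube a l =ᵐ[volume] Metric.closedBall (fun i => a i + l / 2) (l / 2) := by
  have : Metric.closedBall (fun i => a i + l / 2) (l / 2) = Icc a fun i => a i + l := by
    rw [closedBall_pi _ (half_pos hl).le, ← pi_univ_Icc]
    refine congrArg _ (funext fun i => ?_)
    rw [Real.closedBall_eq_Icc]
    congr 1 <;> ring
  rw [this]
  exact Measure.univ_pi_Ioo_ae_eq_Icc

/-- In the sup norm a cube is a closed ball up to a null set. The density theorem for uniformly
locally doubling measures allows balls that merely contain the point, instead of being centred at
it. -/
theorem ae_tendsto_dyadicCube_density (hl : 0 < l) (E : Set (Fin n → ℝ)) :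
    ∀ᵐ x ∂(volume.restrict E : Measure (Fin n → ℝ)),
      Tendsto (fun k => volume (E ∩ dyadicCube a l k (dyadicIndex a l k x)) /
        volume (dyadicCube a l k (dyadicIndex a l k x))) atTop (𝓝 1) := by
  filter_upwards [IsUnifLocDoublingMeasure.ae_tendsto_measure_inter_div
    (volume : Measure (Fin n → ℝ)) E 1, ae_restrict_of_ae (ae_mem_dyadicCube (a := a) hl)]
    with x hx hmem
  have hh : ∀ k : ℕ, 0 < l / 2 ^ k := fun k => by positivity
  have := hx (l := atTop)
    (fun k i => a i + dyadicIndex a l k x i * (l / 2 ^ k) + l / 2 ^ k / 2)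
    (fun k => l / 2 ^ k / 2) ?_ ?_
  · refine this.congr fun k => ?_
    have he := cube_ae_eq_closedBall
      (fun i => a i + dyadicIndex a l k x i * (l / 2 ^ k)) (hh k)
    rw [dyadicCube, measure_congr he, measure_congr ((ae_eq_refl E).inter he)]
  · refine tendsto_nhdsWithin_iff.2 ⟨?_, Eventually.of_forall fun k => half_pos (hh k)⟩
    have := (tendsto_pow_atTop_nhds_zero_of_lt_one (r := (1 / 2 : ℝ)) (by norm_num)
      (by norm_num)).const_mul (l / 2)
    rw [mul_zero] at this
    refine this.congr fun k => ?_
    rw [div_pow, one_pow]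
    ring
  · refine Eventually.of_forall fun k => ?_
    rw [one_mul, mem_closedBall_iff_norm, pi_norm_le_iff_of_nonneg (half_pos (hh k)).le]
    intro i
    obtain ⟨h1, h2⟩ := hmem k i (mem_univ i)
    rw [Real.norm_eq_abs, abs_le]
    simp only [Pi.sub_apply]
    constructor <;> linarith

end Cubes

/-! ### The stopping-time selection of dyadic cells. -/

section Stopping

variable {n : ℕ}

/-- The local Calderón-Zygmund decomposition of a small subset of a cube. -/
theorem exists_stopping_cubes {P : Set (Fin n → ℝ)} (hP : P ∈ cubes n) {E : Set (Fin n → ℝ)}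
    (hE : E ⊆ P) (hsmall : 2 ^ (n + 1) * volume E ≤ volume P) :
    ∃ S : Set (Set (Fin n → ℝ)), S ⊆ cubes n ∧ S.Countable ∧ S.PairwiseDisjoint id ∧
      (∀ D ∈ S, D ⊆ P ∧ 2 * volume (D ∩ E) ≤ volume D) ∧
      volume (⋃₀ S) ≤ 2 ^ (n + 1) * volume E ∧ volume (E \ ⋃₀ S) = 0 := by
  obtain ⟨a, l, hl, rfl⟩ := hP
  -- Of the factor `2 ^ (n + 1)`, passing from a cell to its parent costs `2 ^ n`, and the remaining
  -- `2` leaves half of each selected cell outside `E`.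
  set bad : ℕ → (Fin n → ℤ) → Prop := fun k m =>
    volume (dyadicCube a l k m) < 2 ^ (n + 1) * volume (dyadicCube a l k m ∩ E) with hbad
  -- The maximal bad cells: no proper ancestor is bad.
  set I : Set (ℕ × (Fin n → ℤ)) :=
    {p | bad p.1 p.2 ∧ ∀ k d, 0 < d → k + d = p.1 → ¬ bad k fun i => p.2 i / 2 ^ d} with hI
  -- A bad cell meets `E`, which lies in the root cube. The root itself is not bad by `hsmall`, so
  -- every selected cell has a parent that is not bad.
  have hroot : ∀ {k m}, bad k m → dyadicCube a l k m ⊆ cube a l ∧ k ≠ 0 := by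
    intro k m hb
    have hne : (dyadicCube a l k m ∩ E).Nonempty := by
      by_contra h
      rw [not_nonempty_iff_eq_empty] at h
      simp [hbad, h] at hb
    obtain ⟨y, hy, hyE⟩ := hne
    have h0 : dyadicIndex a l 0 y = 0 :=
      dyadicIndex_eq hl (by rw [dyadicCube_zero]; exact hE hyE)
    have hsub := dyadicCube_subset (a := a) hl 0 k m
    rw [zero_add] at hsub
    have h1 := dyadicIndex_div (a := a) (l := l) 0 k y
    rw [zero_add, dyadicIndex_eq hl hy, h0] at h1
    rw [← h1, dyadicCube_zero] at hsub
    refine ⟨hsub, ?_⟩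
    rintro rfl
    have hm : m = 0 := by rw [← dyadicIndex_eq hl hy, h0]
    simp only [hbad, hm, dyadicCube_zero, inter_eq_self_of_subset_right hE] at hb
    exact hb.not_ge hsmall
  have hdisj : ∀ {p q : ℕ × (Fin n → ℤ)} {x : Fin n → ℝ}, p ∈ I → q ∈ I →
      x ∈ dyadicCube a l p.1 p.2 → x ∈ dyadicCube a l q.1 q.2 → ¬ p.1 < q.1 := by
    intro p q x hp hq hxp hxq hlt
    obtain ⟨d, hd⟩ := Nat.exists_eq_add_of_lt hlt
    refine hq.2 p.1 (d + 1) (Nat.succ_pos _) (by omega) ?_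
    have h1 := dyadicIndex_div (a := a) (l := l) p.1 (d + 1) x
    rw [← add_assoc, ← hd, dyadicIndex_eq hl hxp, dyadicIndex_eq hl hxq] at h1
    rw [← h1]
    exact hp.1
  set S := (fun p : ℕ × (Fin n → ℤ) => dyadicCube a l p.1 p.2) '' I with hS
  have hScubes : S ⊆ cubes n := by
    rintro _ ⟨p, -, rfl⟩
    exact dyadicCube_mem_cubes hl _ _
  have hScount : S.Countable := (to_countable I).image _
  have hSdisj : S.PairwiseDisjoint id := by
    rintro _ ⟨p, hp, rfl⟩ _ ⟨q, hq, rfl⟩ hpq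
    refine Set.disjoint_left.2 fun x hxp hxq => hpq ?_
    have h : p.1 = q.1 := le_antisymm (not_lt.1 (hdisj hq hp hxq hxp)) (not_lt.1 (hdisj hp hq hxp hxq))
    have h' : p.2 = q.2 := by
      rw [← dyadicIndex_eq hl hxp, ← dyadicIndex_eq hl hxq, h]
    simp only [h, h']
  refine ⟨S, hScubes, hScount, hSdisj, ?_, ?_, ?_⟩
  · rintro _ ⟨⟨k, m⟩, hp, rfl⟩
    obtain ⟨hsub, hk⟩ := hroot hp.1
    refine ⟨hsub, ?_⟩
    obtain ⟨j, rfl⟩ := Nat.exists_eq_succ_of_ne_zero hk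
    have hpar := not_lt.1 (hp.2 j 1 one_pos rfl)
    have h1 : volume (dyadicCube a l (j + 1) m ∩ E) ≤
        volume (dyadicCube a l j (fun i => m i / 2 ^ 1) ∩ E) :=
      measure_mono (inter_subset_inter_left _ (dyadicCube_subset hl j 1 m))
    rw [volume_dyadicCube_succ hl j _ m] at hpar
    have h2 := (mul_le_mul_right h1 (2 ^ (n + 1))).trans hpar
    rw [pow_succ, mul_assoc] at h2
    exact (ENNReal.mul_le_mul_iff_right (by positivity) (by finiteness)).1 h2
  · have hm : ∀ D ∈ S, MeasurableSet D := fun D hD => measurableSet_of_mem_cubes (hScubes hD)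
    calc volume (⋃₀ S) = ∑' D : S, volume (D : Set (Fin n → ℝ)) :=
          measure_sUnion hScount hSdisj hm
      -- `E` is not assumed measurable; restricting the measure to `E` keeps additivity over the
      -- measurable cells.
      _ ≤ ∑' D : S, 2 ^ (n + 1) * volume.restrict E (D : Set (Fin n → ℝ)) := by
          refine ENNReal.tsum_le_tsum fun ⟨D, hD⟩ => ?_
          rw [Measure.restrict_apply (hm D hD)]
          obtain ⟨p, hp, rfl⟩ := hD
          exact hp.1.le
      _ = 2 ^ (n + 1) * volume.restrict E (⋃₀ S) := by
          rw [ENNReal.tsum_mul_left, measure_sUnion hScount hSdisj hm]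
      _ ≤ 2 ^ (n + 1) * volume E := by
          refine mul_le_mul_right ?_ _
          exact (measure_mono (subset_univ _)).trans_eq (Measure.restrict_apply_univ _)
  · have hae : ∀ᵐ x ∂(volume.restrict E : Measure (Fin n → ℝ)), x ∈ ⋃₀ S := by
      filter_upwards [ae_tendsto_dyadicCube_density (a := a) hl E,
        ae_restrict_of_ae (ae_mem_dyadicCube (a := a) hl)] with x hx hmem
      -- At a density point of `E` the small cells are almost filled by `E`, hence bad; the first
      -- bad generation gives the maximal cell.
      have hex : ∃ k, bad k (dyadicIndex a l k x) := by
        have hlt : ((2 : ℝ≥0∞) ^ (n + 1))⁻¹ < 1 := by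
          rw [ENNReal.inv_lt_one]
          exact one_lt_pow₀ (by norm_num) (by omega)
        obtain ⟨k, hk⟩ := ((tendsto_order.1 hx).1 _ hlt).exists
        refine ⟨k, ?_⟩
        have hc := dyadicCube_mem_cubes (a := a) hl k (dyadicIndex a l k x)
        rw [ENNReal.lt_div_iff_mul_lt (Or.inl (volume_ne_zero_of_mem_cubes hc))
          (Or.inl (volume_ne_top_of_mem_cubes hc)), mul_comm, ← div_eq_mul_inv,
          ENNReal.div_lt_iff (by simp) (by simp), mul_comm, inter_comm] at hk
        exact hk
      classical
      refine ⟨_, ⟨(Nat.find hex, dyadicIndex a l (Nat.find hex) x), ⟨Nat.find_spec hex, ?_⟩, rfl⟩,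
        hmem _⟩
      intro k d hd hkd
      have := Nat.find_min hex (m := k) (by omega)
      rw [dyadicIndex_div k d x, hkd] at this
      exact this
    have hmS : MeasurableSet (⋃₀ S) :=
      MeasurableSet.sUnion hScount fun D hD => measurableSet_of_mem_cubes (hScubes hD)
    have := ae_iff.1 hae
    rw [show {x | x ∉ ⋃₀ S} = (⋃₀ S)ᶜ from rfl, Measure.restrict_apply hmS.compl] at this
    rwa [Set.sdiff_eq, inter_comm]

end Stopping

end BMOSpaces

/-! ### Sparse layers of cubes and sparse domination. -/

namespace BMOSpaces

/-- Nested layers of pairwise disjoint cubes inside `Q`, such that each cube of a layer is covered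
by the next layer at most up to half of its volume. -/
structure SparseLayers {n : ℕ} (Q : Set (Fin n → ℝ)) (F : ℕ → Set (Set (Fin n → ℝ))) : Prop where
  zero : F 0 = {Q}
  subset_cubes : ∀ k, F k ⊆ cubes n
  countable : ∀ k, (F k).Countable
  disjoint : ∀ k, (F k).PairwiseDisjoint id
  nested : ∀ k, ⋃₀ F (k + 1) ⊆ ⋃₀ F k
  half : ∀ k, ∀ P ∈ F k, 2 * volume (P ∩ ⋃₀ F (k + 1)) ≤ volume P

namespace SparseLayers

variable {n : ℕ} {Q : Set (Fin n → ℝ)} {F : ℕ → Set (Set (Fin n → ℝ))}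

theorem antitone (h : SparseLayers Q F) : Antitone fun k => ⋃₀ F k :=
  antitone_nat_of_succ_le h.nested

theorem sUnion_zero (h : SparseLayers Q F) : ⋃₀ F 0 = Q := by rw [h.zero, sUnion_singleton]

theorem sUnion_subset (h : SparseLayers Q F) (k : ℕ) : ⋃₀ F k ⊆ Q :=
  (h.antitone (Nat.zero_le k)).trans h.sUnion_zero.subset

theorem measurableSet (h : SparseLayers Q F) (k : ℕ) : MeasurableSet (⋃₀ F k) :=
  MeasurableSet.sUnion (h.countable k) fun _ hD =>
    measurableSet_of_mem_cubes (h.subset_cubes k hD)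

theorem lintegral_sUnion (h : SparseLayers Q F) (k : ℕ) (s : Set (Fin n → ℝ))
    (g : (Fin n → ℝ) → ℝ≥0∞) (hs : MeasurableSet s) :
    ∫⁻ x in ⋃₀ F k ∩ s, g x = ∑' P : F k, ∫⁻ x in (P : Set (Fin n → ℝ)) ∩ s, g x := by
  have : ⋃₀ F k ∩ s = ⋃ P ∈ F k, P ∩ s := by
    rw [sUnion_eq_biUnion, iUnion₂_inter]
  rw [this, lintegral_biUnion (h.countable k)
    (fun P hP => (measurableSet_of_mem_cubes (h.subset_cubes k hP)).inter hs)]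
  intro P hP P' hP' hne
  exact (h.disjoint k hP hP' hne).mono inter_subset_left inter_subset_left

theorem volume_sUnion_inter (h : SparseLayers Q F) (k : ℕ) {s : Set (Fin n → ℝ)}
    (hs : MeasurableSet s) :
    volume (⋃₀ F k ∩ s) = ∑' P : F k, volume ((P : Set (Fin n → ℝ)) ∩ s) := by
  simpa using h.lintegral_sUnion k s 1 hs

theorem two_mul_volume_succ_le (h : SparseLayers Q F) (k : ℕ) :
    2 * volume (⋃₀ F (k + 1)) ≤ volume (⋃₀ F k) := by
  have h1 := h.volume_sUnion_inter k (h.measurableSet (k + 1))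
  have h2 := h.volume_sUnion_inter k MeasurableSet.univ
  simp only [inter_univ] at h2
  rw [inter_eq_self_of_subset_right (h.nested k)] at h1
  rw [h1, h2, ← ENNReal.tsum_mul_left]
  exact ENNReal.tsum_le_tsum fun P => h.half k P P.2

theorem volume_sUnion_le (h : SparseLayers Q F) (k : ℕ) :
    volume (⋃₀ F k) ≤ (2⁻¹) ^ k * volume Q := by
  induction k with
  | zero => rw [h.sUnion_zero, pow_zero, one_mul]
  | succ k ih =>
    calc volume (⋃₀ F (k + 1)) = 2⁻¹ * (2 * volume (⋃₀ F (k + 1))) := by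
          rw [← mul_assoc, ENNReal.inv_mul_cancel (by norm_num) (by norm_num), one_mul]
      _ ≤ 2⁻¹ * volume (⋃₀ F k) := by gcongr; exact h.two_mul_volume_succ_le k
      _ ≤ 2⁻¹ * ((2⁻¹) ^ k * volume Q) := by gcongr
      _ = _ := by rw [pow_succ]; ring

theorem tsum_volume_le (h : SparseLayers Q F) : ∑' k, volume (⋃₀ F k) ≤ 2 * volume Q := by
  refine (ENNReal.tsum_le_tsum h.volume_sUnion_le).trans ?_
  rw [ENNReal.tsum_mul_right, ENNReal.tsum_geometric, ENNReal.one_sub_inv_two, inv_inv]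

/-- The layer volumes decay geometrically, so the intersection of all layers is null. -/
theorem ae_exists_notMem (h : SparseLayers Q F) (hQ : volume Q ≠ ∞) :
    ∀ᵐ x ∂volume, ∃ k, x ∉ ⋃₀ F k := by
  have hle : ∀ k, volume (⋂ k, ⋃₀ F k) ≤ (2⁻¹) ^ k * volume Q := fun k =>
    (measure_mono (iInter_subset _ k)).trans (h.volume_sUnion_le k)
  have hlim : Tendsto (fun k : ℕ => (2⁻¹ : ℝ≥0∞) ^ k * volume Q) atTop (𝓝 0) := by
    have := ENNReal.Tendsto.mul_const (b := volume Q)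
      (ENNReal.tendsto_pow_atTop_nhds_zero_of_lt_one (r := 2⁻¹) (by simp)) (Or.inr hQ)
    rwa [zero_mul] at this
  have h0 : volume (⋂ k, ⋃₀ F k) = 0 := le_antisymm (ge_of_tendsto' hlim hle) zero_le
  filter_upwards [measure_eq_zero_iff_ae_notMem.1 h0] with x hx
  simpa only [mem_iInter, not_forall] using hx

theorem volume_diff (h : SparseLayers Q F) (k : ℕ) {P : Set (Fin n → ℝ)} (hP : P ∈ F k) :
    volume P ≤ 2 * volume (P \ ⋃₀ F (k + 1)) := by
  have hfin := volume_ne_top_of_mem_cubes (h.subset_cubes k hP)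
  have hsplit := measure_inter_add_sdiff (μ := volume) P (h.measurableSet (k + 1))
  have hhalf := h.half k P hP
  rw [← hsplit, two_mul] at hhalf
  have hfin' : volume (P ∩ ⋃₀ F (k + 1)) ≠ ∞ :=
    ne_top_of_le_ne_top hfin (measure_mono inter_subset_left)
  have := (ENNReal.add_le_add_iff_left hfin').1 hhalf
  rw [← hsplit, two_mul]
  gcongr

end SparseLayers

section Domination

variable {n : ℕ}

/-- Iterates the stopping construction inside each cube of the current layer. The exponent is `n +
2` since the stopping cubes have total volume at most `2 ^ (n + 1)` times that of `G P`, and this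
must be at most half of `P`. -/
theorem exists_sparseLayers {Q : Set (Fin n → ℝ)} (hQ : Q ∈ cubes n)
    (G : Set (Fin n → ℝ) → Set (Fin n → ℝ)) (hG : ∀ P, G P ⊆ P)
    (hsmall : ∀ P ∈ cubes n, 2 ^ (n + 2) * volume (G P) ≤ volume P) :
    ∃ F, SparseLayers Q F ∧
      (∀ k, ∀ D ∈ F (k + 1), ∃ P ∈ F k, D ⊆ P ∧ 2 * volume (D ∩ G P) ≤ volume D) ∧
      ∀ k, ∀ P ∈ F k, volume (G P \ ⋃₀ F (k + 1)) = 0 := by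
  have hex : ∀ P : Set (Fin n → ℝ), ∃ S : Set (Set (Fin n → ℝ)), P ∈ cubes n →
      S ⊆ cubes n ∧ S.Countable ∧ S.PairwiseDisjoint id ∧
      (∀ D ∈ S, D ⊆ P ∧ 2 * volume (D ∩ G P) ≤ volume D) ∧
      volume (⋃₀ S) ≤ 2 ^ (n + 1) * volume (G P) ∧ volume (G P \ ⋃₀ S) = 0 := by
    intro P
    by_cases hP : P ∈ cubes n
    · obtain ⟨S, hS⟩ := exists_stopping_cubes hP (hG P) (le_trans (by gcongr <;> norm_num)
        (hsmall P hP))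
      exact ⟨S, fun _ => hS⟩
    · exact ⟨∅, fun h => absurd h hP⟩
  choose S hS using hex
  set F : ℕ → Set (Set (Fin n → ℝ)) := fun k => Nat.rec {Q} (fun _ F => ⋃ P ∈ F, S P) k with hF
  have hF0 : F 0 = {Q} := rfl
  have hFs : ∀ k, F (k + 1) = ⋃ P ∈ F k, S P := fun k => rfl
  have hsub : ∀ k, F k ⊆ cubes n := by
    intro k
    induction k with
    | zero => rw [hF0, singleton_subset_iff]; exact hQ
    | succ k ih =>
      rw [hFs]
      exact iUnion₂_subset fun P hP => (hS P (ih hP)).1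
  have hSP : ∀ k, ∀ P ∈ F k, ∀ D ∈ S P, D ⊆ P := fun k P hP D hD =>
    ((hS P (hsub k hP)).2.2.2.1 D hD).1
  have hdisj : ∀ k, (F k).PairwiseDisjoint id := by
    intro k
    induction k with
    | zero => rw [hF0]; exact pairwiseDisjoint_singleton _ _
    | succ k ih =>
      rw [hFs]
      intro D hD D' hD' hne
      simp only [mem_iUnion, exists_prop] at hD hD'
      obtain ⟨P, hP, hD⟩ := hD
      obtain ⟨P', hP', hD'⟩ := hD'
      by_cases hPP : P = P'
      · subst hPP
        exact (hS P (hsub k hP)).2.2.1 hD hD' hne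
      · exact (ih hP hP' hPP).mono (hSP k P hP D hD) (hSP k P' hP' D' hD')
  -- Cubes of one layer are disjoint, so only descendants of `P` meet `P`.
  have hinter : ∀ k, ∀ P ∈ F k, P ∩ ⋃₀ F (k + 1) ⊆ ⋃₀ S P := by
    rintro k P hP x ⟨hxP, D, hD, hxD⟩
    rw [hFs] at hD
    simp only [mem_iUnion, exists_prop] at hD
    obtain ⟨P', hP', hD⟩ := hD
    have : P = P' := (hdisj k).elim hP hP'
      (Set.not_disjoint_iff.2 ⟨x, hxP, hSP k P' hP' D hD hxD⟩)
    subst this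
    exact ⟨D, hD, hxD⟩
  have hSsub : ∀ k, ∀ P ∈ F k, S P ⊆ F (k + 1) := fun k P hP => by
    rw [hFs]
    exact subset_iUnion₂ (s := fun P _ => S P) P hP
  refine ⟨F, ⟨hF0, hsub, ?_, hdisj, ?_, ?_⟩, ?_, ?_⟩
  · intro k
    induction k with
    | zero => rw [hF0]; exact countable_singleton _
    | succ k ih =>
      rw [hFs]
      exact ih.biUnion fun P hP => (hS P (hsub k hP)).2.1
  · rintro k x ⟨D, hD, hx⟩
    rw [hFs] at hD
    simp only [mem_iUnion, exists_prop] at hD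
    obtain ⟨P, hP, hD⟩ := hD
    exact ⟨P, hP, hSP k P hP D hD hx⟩
  · intro k P hP
    calc 2 * volume (P ∩ ⋃₀ F (k + 1)) ≤ 2 * (2 ^ (n + 1) * volume (G P)) := by
          gcongr
          exact (measure_mono (hinter k P hP)).trans (hS P (hsub k hP)).2.2.2.2.1
      _ = 2 ^ (n + 2) * volume (G P) := by ring
      _ ≤ volume P := hsmall P (hsub k hP)
  · intro k D hD
    rw [hFs] at hD
    simp only [mem_iUnion, exists_prop] at hD
    obtain ⟨P, hP, hD⟩ := hD
    exact ⟨P, hP, (hS P (hsub k hP)).2.2.2.1 D hD⟩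
  · intro k P hP
    refine measure_mono_null ?_ (hS P (hsub k hP)).2.2.2.2.2
    exact sdiff_subset_sdiff_right (sUnion_subset_sUnion (hSsub k P hP))

/-- Sparse domination of a function whose oscillation on every cube is small outside a small
portion of the cube. -/
theorem exists_sparse_domination {f : (Fin n → ℝ) → ℝ} {c : Set (Fin n → ℝ) → ℝ} {t : ℝ}
    (ht : 0 ≤ t)
    (hosc : ∀ P ∈ cubes n, 2 ^ (n + 2) * volume {x ∈ P | t < |f x - c P|} ≤ volume P)
    {Q : Set (Fin n → ℝ)} (hQ : Q ∈ cubes n) :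
    ∃ F, SparseLayers Q F ∧ ∀ᵐ x ∂volume, x ∈ Q →
      ‖f x - c Q‖ₑ ≤ ENNReal.ofReal (2 * t) * ∑' k, (⋃₀ F k).indicator 1 x := by
  obtain ⟨F, hF, hpar, hnull⟩ := exists_sparseLayers hQ (fun P => {x ∈ P | t < |f x - c P|})
    (fun P => sep_subset _ _) hosc
  refine ⟨F, hF, ?_⟩
  -- Each generation moves the constant by at most `2 * t`, because a cube and its parent in the
  -- layers have a common good point.
  have hc : ∀ k, ∀ P ∈ F k, |c P - c Q| ≤ 2 * t * k := by
    intro k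
    induction k with
    | zero =>
      intro P hP
      rw [hF.zero, mem_singleton_iff] at hP
      simp [hP]
    | succ k ih =>
      intro D hD
      obtain ⟨P, hP, hDsub, hDP⟩ := hpar k D hD
      have hDc := hF.subset_cubes _ hD
      -- The points of `D` that are bad for `P` fill at most half of `D`, and those bad for `D` at
      -- most a quarter, so some point is good for both.
      have hne : ∃ x ∈ D, |f x - c P| ≤ t ∧ |f x - c D| ≤ t := by
        by_contra! hcon
        have hsub : D ⊆ (D ∩ {x ∈ P | t < |f x - c P|}) ∪ {x ∈ D | t < |f x - c D|} := by
          intro x hx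
          rcases le_or_gt |f x - c P| t with h | h
          · exact Or.inr ⟨hx, hcon x hx h⟩
          · exact Or.inl ⟨hx, hDsub hx, h⟩
        have h4 : (4 : ℝ≥0∞) ≤ 2 ^ (n + 2) := by
          rw [pow_add]
          calc (4 : ℝ≥0∞) = 1 * 2 ^ 2 := by norm_num
            _ ≤ _ := by gcongr; exact one_le_pow₀ (by norm_num)
        have hle : 4 * volume D ≤ 3 * volume D :=
          calc 4 * volume D
              ≤ 4 * (volume (D ∩ {x ∈ P | t < |f x - c P|}) + volume {x ∈ D | t < |f x - c D|}) := by
                gcongr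
                exact (measure_mono hsub).trans (measure_union_le _ _)
            _ = 2 * (2 * volume (D ∩ {x ∈ P | t < |f x - c P|})) +
                4 * volume {x ∈ D | t < |f x - c D|} := by ring
            _ ≤ 2 * volume D + volume D := by
                gcongr
                exact le_trans (by gcongr) (hosc D hDc)
            _ = 3 * volume D := by ring
        refine hle.not_gt ?_
        rw [ENNReal.mul_lt_mul_iff_left (volume_ne_zero_of_mem_cubes hDc)
          (volume_ne_top_of_mem_cubes hDc)]
        norm_num
      obtain ⟨x, -, h1, h2⟩ := hne
      have h3 := abs_sub_le (c D) (f x) (c P)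
      have h4 := abs_sub_le (c D) (c P) (c Q)
      rw [abs_sub_comm (c D) (f x)] at h3
      have := ih P hP
      push_cast
      linarith
  have hae : ∀ᵐ x ∂volume, ∀ k, ∀ P ∈ F k, x ∉ {x ∈ P | t < |f x - c P|} \ ⋃₀ F (k + 1) := by
    rw [ae_all_iff]
    intro k
    rw [ae_ball_iff (hF.countable k)]
    exact fun P hP => measure_eq_zero_iff_ae_notMem.1 (hnull k P hP)
  filter_upwards [hae, hF.ae_exists_notMem (volume_ne_top_of_mem_cubes hQ)] with x hx hex hxQ
  classical
  -- `k` is the last layer containing `x`, so the sum of indicators at `x` is `k + 1`.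
  obtain ⟨k, hk⟩ : ∃ k, Nat.find hex = k + 1 := by
    refine Nat.exists_eq_succ_of_ne_zero fun h0 => ?_
    have := Nat.find_spec hex
    rw [h0, hF.sUnion_zero] at this
    exact this hxQ
  have hmem : ∀ j ≤ k, x ∈ ⋃₀ F j := fun j hj => not_not.1 (Nat.find_min hex (by omega))
  have hnot : x ∉ ⋃₀ F (k + 1) := hk ▸ Nat.find_spec hex
  obtain ⟨P, hP, hxP⟩ := hmem k le_rfl
  have h1 : |f x - c P| ≤ t := by
    by_contra! h
    exact hx k P hP ⟨⟨hxP, h⟩, hnot⟩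
  -- `t` from the last cube and `2 * t * k` from the chain of constants.
  have h2 : |f x - c Q| ≤ 2 * t * (k + 1 : ℕ) := by
    have h3 := abs_sub_le (f x) (c P) (c Q)
    have h4 := hc k P hP
    push_cast
    linarith
  calc ‖f x - c Q‖ₑ ≤ ENNReal.ofReal (2 * t * (k + 1 : ℕ)) := by
        rw [← Real.enorm_abs, Real.enorm_eq_ofReal (abs_nonneg _)]
        exact ENNReal.ofReal_le_ofReal h2
    _ = ENNReal.ofReal (2 * t) * ∑ j ∈ Finset.range (k + 1), (⋃₀ F j).indicator 1 x := by
        rw [Finset.sum_congr rfl (g := fun _ => 1) fun j hj => ?_]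
        · rw [ENNReal.ofReal_mul (by positivity), ENNReal.ofReal_natCast]
          simp
        · rw [indicator_of_mem (hmem j (by simpa [Nat.lt_succ_iff] using hj)), Pi.one_apply]
    _ ≤ _ := by
        gcongr
        exact ENNReal.sum_le_tsum _

end Domination

end BMOSpaces

/-! ### Indicators, the maximal function, and the two inequalities required of `X`. -/

namespace BMOSpaces

section Chi

variable {n : ℕ}

theorem measurable_chi {E : Set (Fin n → ℝ)} (hE : MeasurableSet E) : Measurable (chi E) :=
  measurable_const.indicator hE

theorem enorm_chi (E : Set (Fin n → ℝ)) (x : Fin n → ℝ) : ‖chi E x‖ₑ = E.indicator 1 x := by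
  by_cases hx : x ∈ E <;> simp [chi, hx]

theorem abs_chi_le_abs_chi {E E' : Set (Fin n → ℝ)} (h : E ⊆ E') (x : Fin n → ℝ) :
    |chi E x| ≤ |chi E' x| := by
  by_cases hx : x ∈ E
  · simp [chi, hx, h hx]
  · simp [chi, hx]

theorem lintegral_chi_mul {E : Set (Fin n → ℝ)} (hE : MeasurableSet E)
    (g : (Fin n → ℝ) → ℝ≥0∞) : ∫⁻ x, ‖chi E x‖ₑ * g x = ∫⁻ x in E, g x := by
  rw [← lintegral_indicator hE]
  refine lintegral_congr fun x => ?_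
  rw [enorm_chi]
  by_cases hx : x ∈ E <;> simp [hx]

theorem laverage_le_maximal (f : (Fin n → ℝ) → ℝ) {Q : Set (Fin n → ℝ)} (hQ : Q ∈ cubes n)
    {x : Fin n → ℝ} (hx : x ∈ Q) : ⨍⁻ y in Q, ‖f y‖ₑ ∂volume ≤ maximal f x :=
  le_iSup₂_of_le (f := fun Q (_ : Q ∈ cubes n) => ⨆ _ : x ∈ Q, ⨍⁻ y in Q, ‖f y‖ₑ ∂volume) Q hQ
    (le_iSup (fun _ : x ∈ Q => ⨍⁻ y in Q, ‖f y‖ₑ ∂volume) hx)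

theorem volume_inter_div_le_maximal {E : Set (Fin n → ℝ)} (hE : MeasurableSet E)
    {Q : Set (Fin n → ℝ)} (hQ : Q ∈ cubes n) {x : Fin n → ℝ} (hx : x ∈ Q) :
    volume (Q ∩ E) / volume Q ≤ maximal (chi E) x := by
  refine le_trans (le_of_eq ?_) (laverage_le_maximal _ hQ hx)
  rw [setLAverage_eq]
  congr 1
  simp_rw [enorm_chi]
  rw [lintegral_indicator_one hE, Measure.restrict_apply hE, inter_comm]

theorem exists_cube_superset {A : Set (Fin n → ℝ)} (hA : Bornology.IsBounded A) :
    ∃ Q ∈ cubes n, A ⊆ Q := by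
  obtain ⟨R, hR, hAR⟩ := hA.subset_ball_lt 0 0
  refine ⟨cube (fun _ => -R) (2 * R), ⟨_, _, by positivity, rfl⟩, fun x hx i _ => ?_⟩
  have h1 := mem_ball_zero_iff.1 (hAR hx)
  have h2 := (norm_le_pi_norm x i).trans_lt h1
  rw [Real.norm_eq_abs, abs_lt] at h2
  constructor <;> linarith

theorem isBounded_of_mem_cubes {Q : Set (Fin n → ℝ)} (hQ : Q ∈ cubes n) :
    Bornology.IsBounded Q := by
  obtain ⟨a, l, -, rfl⟩ := hQ
  exact Bornology.IsBounded.pi fun i => Metric.isBounded_Ioo _ _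

end Chi

namespace BanachFunctionSpace

variable {n : ℕ} (X : BanachFunctionSpace n)

/-- Relative volumes are controlled by relative norms of indicators. -/
def VolumeBound (C : ℝ≥0) : Prop :=
  ∀ Q ∈ cubes n, ∀ E ⊆ Q, MeasurableSet E →
    volume E * X.eNrm (chi Q) ≤ C * (volume Q * X.eNrm (chi E))

/-- Functions that are dominated by sparse layers in `Q` are controlled by `χ_Q`. -/
def SparseBound (C : ℝ≥0) : Prop :=
  ∀ Q ∈ cubes n, ∀ F, SparseLayers Q F → ∀ f : (Fin n → ℝ) → ℝ, AEMeasurable f volume →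
    (∀ᵐ x ∂volume, ‖f x‖ₑ ≤ ∑' k, (⋃₀ F k).indicator 1 x) → X.eNrm f ≤ C * X.eNrm (chi Q)

variable {X}

theorem eNrm_chi_mono {E E' : Set (Fin n → ℝ)} (hE : MeasurableSet E) (h : E ⊆ E') :
    X.eNrm (chi E) ≤ X.eNrm (chi E') :=
  X.eNrm_mono (measurable_chi hE).aemeasurable (Eventually.of_forall (abs_chi_le_abs_chi h))

theorem eNrm_chi_ne_zero {E : Set (Fin n → ℝ)} (h : volume E ≠ 0) : X.eNrm (chi E) ≠ 0 := by
  intro h0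
  refine h (measure_eq_zero_iff_ae_notMem.2 ?_)
  filter_upwards [X.ae_eq_zero_of_eNrm_eq_zero h0] with x hx hxE
  simp [chi, hxE] at hx

theorem lintegral_tsum_indicator_mul_le {Q : Set (Fin n → ℝ)} {F : ℕ → Set (Set (Fin n → ℝ))}
    (hF : SparseLayers Q F) {f : (Fin n → ℝ) → ℝ}
    (hf : ∀ᵐ x ∂volume, ‖f x‖ₑ ≤ ∑' k, (⋃₀ F k).indicator 1 x) {g : (Fin n → ℝ) → ℝ≥0∞}
    (hg : AEMeasurable g volume) :
    ∫⁻ x, ‖f x‖ₑ * g x ≤ ∑' k, ∫⁻ x in ⋃₀ F k, g x := by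
  calc ∫⁻ x, ‖f x‖ₑ * g x ≤ ∫⁻ x, ∑' k, ‖chi (⋃₀ F k) x‖ₑ * g x := by
        refine lintegral_mono_ae ?_
        filter_upwards [hf] with x hx
        rw [ENNReal.tsum_mul_right]
        simp_rw [enorm_chi]
        gcongr
    _ = ∑' k, ∫⁻ x, ‖chi (⋃₀ F k) x‖ₑ * g x :=
        lintegral_tsum fun k => (measurable_chi (hF.measurableSet k)).enorm.aemeasurable.mul hg
    _ = _ := by simp_rw [lintegral_chi_mul (hF.measurableSet _)]

/-! ### Both inequalities when the maximal operator is bounded on `X'`. -/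

section MaximalOnAssociate

/-- On `Q` the average of `|g|` is at most `maximal g`; Hölder's inequality with `h` does the rest.
-/
theorem laverage_mul_lintegral_le {g : L0 n} {C : ℝ≥0∞} (hg : X.assocENrm (maximal g) ≤ C)
    {h : (Fin n → ℝ) → ℝ} (hh : X.eNrm h ≠ ∞) {Q : Set (Fin n → ℝ)} (hQ : Q ∈ cubes n) :
    (⨍⁻ y in Q, ‖g y‖ₑ ∂volume) * ∫⁻ x in Q, ‖h x‖ₑ ≤ C * X.eNrm h := by
  have hm := X.aemeasurable_of_eNrm_ne_top hh
  calc (⨍⁻ y in Q, ‖g y‖ₑ ∂volume) * ∫⁻ x in Q, ‖h x‖ₑ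
      = ∫⁻ x in Q, ‖h x‖ₑ * ⨍⁻ y in Q, ‖g y‖ₑ ∂volume := by
        rw [lintegral_mul_const'' _ hm.enorm.restrict, mul_comm]
    _ ≤ ∫⁻ x in Q, ‖h x‖ₑ * maximal g x := by
        refine setLIntegral_mono' (measurableSet_of_mem_cubes hQ) fun x hx => ?_
        gcongr
        exact laverage_le_maximal _ hQ hx
    _ ≤ ∫⁻ x, ‖h x‖ₑ * maximal g x := setLIntegral_le_lintegral _ _
    _ ≤ X.eNrm h * X.assocENrm (maximal g) := X.lintegral_mul_le hh _
    _ ≤ C * X.eNrm h := by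
        rw [mul_comm]
        gcongr

theorem lintegral_eq_volume_mul_laverage {Q : Set (Fin n → ℝ)} (hQ : Q ∈ cubes n)
    (g : (Fin n → ℝ) → ℝ≥0∞) :
    ∫⁻ x in Q, g x = volume Q * ⨍⁻ y in Q, g y ∂volume := by
  rw [setLAverage_eq, ENNReal.mul_div_cancel (volume_ne_zero_of_mem_cubes hQ)
    (volume_ne_top_of_mem_cubes hQ)]

theorem MaximalBoundedOnAssociate.exists_bound (hX : X.MaximalBoundedOnAssociate) :
    ∃ C : ℝ≥0, ∀ g : L0 n, X.assocENrm (fun x => ‖g x‖ₑ) ≤ 1 →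
      X.assocENrm (maximal g) ≤ C := by
  obtain ⟨C, hC⟩ := hX
  refine ⟨C, fun g hg => (hC g (hg.trans_lt ENNReal.one_lt_top)).trans ?_⟩
  exact mul_le_of_le_one_right' hg

/-- By duality it suffices to bound averages of `g` over `Q`. One estimate serves twice: with `h` an
order unit it gives `‖χ_Q‖_X < ∞`, and with `h = χ_E` it gives `VolumeBound`. -/
theorem MaximalBoundedOnAssociate.eNrm_chi_le (hX : X.MaximalBoundedOnAssociate) :
    ∃ C : ℝ≥0, ∀ Q ∈ cubes n, ∀ h : (Fin n → ℝ) → ℝ, X.eNrm h ≠ ∞ → ∫⁻ x in Q, ‖h x‖ₑ ≠ 0 →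
      X.eNrm (chi Q) ≤ volume Q * (C * X.eNrm h / ∫⁻ x in Q, ‖h x‖ₑ) := by
  obtain ⟨C, hC⟩ := hX.exists_bound
  refine ⟨C, fun Q hQ h hh h0 => ?_⟩
  have hm := measurableSet_of_mem_cubes hQ
  refine X.eNrm_le_of_forall_assoc (measurable_chi hm).aemeasurable fun g hg => ?_
  rw [lintegral_chi_mul hm, lintegral_eq_volume_mul_laverage hQ]
  gcongr
  rw [ENNReal.le_div_iff_mul_le (Or.inl h0) (Or.inr (by finiteness))]
  exact laverage_mul_lintegral_le (hC g hg) hh hQ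

theorem MaximalBoundedOnAssociate.eNrm_chi_ne_top (hX : X.MaximalBoundedOnAssociate)
    {Q : Set (Fin n → ℝ)} (hQ : Q ∈ cubes n) : X.eNrm (chi Q) ≠ ∞ := by
  obtain ⟨C, hC⟩ := hX.eNrm_chi_le
  obtain ⟨u, hum, -, hupos, hu⟩ := X.exists_order_unit
  have h0 : ∫⁻ x in Q, ‖u x‖ₑ ≠ 0 := by
    rw [Ne, lintegral_eq_zero_iff hum.enorm]
    intro h
    have : ∀ᵐ x ∂volume.restrict Q, False := by
      filter_upwards [h, ae_restrict_of_ae hupos] with x h1 h2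
      simp only [Pi.zero_apply, enorm_eq_zero] at h1
      exact h2.ne' h1
    rw [eventually_false_iff_eq_bot, ae_eq_bot, Measure.restrict_eq_zero] at this
    exact volume_ne_zero_of_mem_cubes hQ this
  refine ne_top_of_le_ne_top ?_ (hC Q hQ u hu h0)
  have := volume_ne_top_of_mem_cubes hQ
  exact ENNReal.mul_ne_top this (ENNReal.div_ne_top (by finiteness) h0)

theorem MaximalBoundedOnAssociate.volumeBound (hX : X.MaximalBoundedOnAssociate) :
    ∃ C, X.VolumeBound C := by
  obtain ⟨C, hC⟩ := hX.eNrm_chi_le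
  refine ⟨C, fun Q hQ E hEQ hE => ?_⟩
  rcases eq_or_ne (volume E) 0 with h0 | h0
  · rw [h0, zero_mul]
    exact zero_le
  have hfin : X.eNrm (chi E) ≠ ∞ :=
    ne_top_of_le_ne_top (hX.eNrm_chi_ne_top hQ) (eNrm_chi_mono hE hEQ)
  have hint : ∫⁻ x in Q, ‖chi E x‖ₑ = volume E := by
    simp_rw [enorm_chi]
    rw [lintegral_indicator_one hE, Measure.restrict_apply hE, inter_eq_self_of_subset_left hEQ]
  have := hC Q hQ (chi E) hfin (by rwa [hint])
  rw [hint] at this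
  calc volume E * X.eNrm (chi Q)
      ≤ volume E * (volume Q * (C * X.eNrm (chi E) / volume E)) := by gcongr
    _ = volume Q * (volume E * (C * X.eNrm (chi E) / volume E)) := by ring
    _ ≤ volume Q * (C * X.eNrm (chi E)) :=
        mul_le_mul_right ENNReal.mul_div_le _
    _ = _ := by ring

/-- Pairing with `g` leaves a sum of `∫_P |g| = |P| ⟨|g|⟩_P` over all cubes of all layers.
Sparseness replaces `|P|` by twice the volume of the part of `P` outside the next layer. These parts
are disjoint in `Q` and `⟨|g|⟩_P ≤ Mg` there, so the total is at most `2 ∫_Q Mg`. -/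
theorem MaximalBoundedOnAssociate.sparseBound (hX : X.MaximalBoundedOnAssociate) :
    ∃ C, X.SparseBound C := by
  obtain ⟨C, hC⟩ := hX.exists_bound
  refine ⟨2 * C, fun Q hQ F hF f hfm hf => X.eNrm_le_of_forall_assoc hfm fun g hg => ?_⟩
  have hmE : ∀ k, MeasurableSet (⋃₀ F k \ ⋃₀ F (k + 1)) := fun k =>
    (hF.measurableSet k).diff (hF.measurableSet (k + 1))
  have hlayer : ∀ k, ∫⁻ x in ⋃₀ F k, ‖g x‖ₑ ≤
      2 * ∫⁻ x in ⋃₀ F k \ ⋃₀ F (k + 1), maximal g x := by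
    intro k
    have h1 := hF.lintegral_sUnion k univ (fun x => ‖g x‖ₑ) MeasurableSet.univ
    have h2 := hF.lintegral_sUnion k (⋃₀ F (k + 1))ᶜ (maximal g) (hF.measurableSet _).compl
    simp only [inter_univ] at h1
    rw [h1, Set.sdiff_eq, h2, ← ENNReal.tsum_mul_left]
    refine ENNReal.tsum_le_tsum fun ⟨P, hP⟩ => ?_
    have hPc := hF.subset_cubes k hP
    calc ∫⁻ x in P, ‖g x‖ₑ = volume P * ⨍⁻ y in P, ‖g y‖ₑ ∂volume :=
          lintegral_eq_volume_mul_laverage hPc _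
      _ ≤ 2 * volume (P \ ⋃₀ F (k + 1)) * ⨍⁻ y in P, ‖g y‖ₑ ∂volume := by
          gcongr
          exact hF.volume_diff k hP
      _ = 2 * ∫⁻ x in P \ ⋃₀ F (k + 1), ⨍⁻ y in P, ‖g y‖ₑ ∂volume := by
          rw [setLIntegral_const]
          ring
      _ ≤ 2 * ∫⁻ x in P ∩ (⋃₀ F (k + 1))ᶜ, maximal g x := by
          rw [Set.sdiff_eq]
          gcongr 2 * ?_
          refine setLIntegral_mono' ((measurableSet_of_mem_cubes hPc).inter
            (hF.measurableSet _).compl) fun x hx => laverage_le_maximal _ hPc hx.1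
  have hdisj : Pairwise (Function.onFun Disjoint fun k => ⋃₀ F k \ ⋃₀ F (k + 1)) := by
    refine (pairwise_disjoint_on _).2 fun j k hjk => ?_
    refine Set.disjoint_left.2 fun x hx hx' => hx.2 ?_
    exact hF.antitone (Nat.succ_le_of_lt hjk) hx'.1
  have hmQ := measurableSet_of_mem_cubes hQ
  calc ∫⁻ x, ‖f x‖ₑ * ‖g x‖ₑ ≤ ∑' k, ∫⁻ x in ⋃₀ F k, ‖g x‖ₑ :=
        lintegral_tsum_indicator_mul_le hF hf (AEEqFun.aemeasurable g).enorm
    _ ≤ ∑' k, 2 * ∫⁻ x in ⋃₀ F k \ ⋃₀ F (k + 1), maximal g x := ENNReal.tsum_le_tsum hlayer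
    _ = 2 * ∫⁻ x in ⋃ k, ⋃₀ F k \ ⋃₀ F (k + 1), maximal g x := by
        rw [ENNReal.tsum_mul_left, lintegral_iUnion hmE hdisj]
    _ ≤ 2 * ∫⁻ x in Q, maximal g x := by
        gcongr 2 * ?_
        exact lintegral_mono_set (iUnion_subset fun k => sdiff_subset.trans (hF.sUnion_subset k))
    _ ≤ 2 * (X.eNrm (chi Q) * X.assocENrm (maximal g)) := by
        gcongr
        rw [← lintegral_chi_mul hmQ]
        exact X.lintegral_mul_le (hX.eNrm_chi_ne_top hQ) _
    _ ≤ 2 * (X.eNrm (chi Q) * C) := by gcongr; exact hC g hg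
    _ = _ := by push_cast; ring

end MaximalOnAssociate

/-! ### Finiteness and the volume inequality under the restricted weak type bound. -/

section RestrictedWeakType

theorem MaximalRestrictedWeakType.eNrm_chi_le (hX : X.MaximalRestrictedWeakType) :
    ∃ C : ℝ≥0, ∀ E A : Set (Fin n → ℝ), MeasurableSet E → MeasurableSet A → ∀ r : ℝ≥0∞, r ≠ ∞ →
      (∀ x ∈ A, r ≤ maximal (chi E) x) → r * X.eNrm (chi A) ≤ C * X.eNrm (chi E) := by
  obtain ⟨C, hC⟩ := hX
  refine ⟨2 * C, fun E A hE hA r hr h => ?_⟩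
  rcases eq_or_ne r 0 with rfl | h0
  · rw [zero_mul]
    exact zero_le
  have hr2 : r / 2 ≠ ∞ := ENNReal.div_ne_top hr (by norm_num)
  -- The weak type bound concerns a strict inequality, so level `r / 2` is used at the cost of a
  -- factor `2`.
  have ht := hC E hE (r / 2).toReal (ENNReal.toReal_pos (by simpa using h0) hr2)
  rw [ENNReal.ofReal_toReal hr2] at ht
  have hsub : A ⊆ {x | r / 2 < maximal (chi E) x} := fun x hx =>
    (ENNReal.half_lt_self h0 hr).trans_le (h x hx)
  calc r * X.eNrm (chi A) = 2 * (r / 2 * X.eNrm (chi A)) := by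
        rw [← mul_assoc, ENNReal.mul_div_cancel (by norm_num) (by norm_num)]
    _ ≤ 2 * (C * X.eNrm (chi E)) := by
        gcongr 2 * ?_
        refine le_trans ?_ ht
        gcongr
        exact eNrm_chi_mono hA hsub
    _ = _ := by push_cast; ring

/-- On a set where an order unit `u` is at least `1 / (N + 1)`, the indicator is dominated by a
multiple of `u`. Intersected with balls, these sets exhaust the space a.e. -/
theorem exists_eNrm_chi_ne_top (X : BanachFunctionSpace n) : ∃ E : Set (Fin n → ℝ), MeasurableSet E ∧
    Bornology.IsBounded E ∧ volume E ≠ 0 ∧ X.eNrm (chi E) ≠ ∞ := by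
  obtain ⟨u, hum, hu0, hupos, hu⟩ := X.exists_order_unit
  set E : ℕ → Set (Fin n → ℝ) := fun N =>
    Metric.closedBall 0 N ∩ {x | 1 ≤ (N + 1 : ℝ) * u x} with hE
  have hmE : ∀ N, MeasurableSet (E N) := fun N =>
    Metric.isClosed_closedBall.measurableSet.inter
      (measurableSet_le measurable_const (hum.const_mul _))
  obtain ⟨N, hN⟩ : ∃ N, volume (E N) ≠ 0 := by
    by_contra! hall
    have h1 : volume (⋃ N, E N) = 0 := measure_iUnion_null hall
    have : ∀ᵐ x ∂(volume : Measure (Fin n → ℝ)), False := by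
      filter_upwards [measure_eq_zero_iff_ae_notMem.1 h1, hupos] with x hx hux
      obtain ⟨N, hN⟩ := exists_nat_ge (max ‖x‖ (u x)⁻¹)
      refine hx (mem_iUnion.2 ⟨N, ?_, ?_⟩)
      · simpa using (le_max_left _ _).trans hN
      · have := (le_max_right _ _).trans hN
        rw [inv_le_iff_one_le_mul₀ hux] at this
        show 1 ≤ (N + 1 : ℝ) * u x
        linarith
    rw [eventually_false_iff_eq_bot, ae_eq_bot] at this
    exact NeZero.ne _ this
  refine ⟨E N, hmE N, Metric.isBounded_closedBall.subset inter_subset_left, hN, ?_⟩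
  have hN0 : (N + 1 : ℝ) ≠ 0 := by positivity
  refine ne_top_of_le_ne_top (b := X.eNrm fun x => (N + 1 : ℝ) * u x) ?_
    (X.eNrm_mono (measurable_chi (hmE N)).aemeasurable (Eventually.of_forall fun x => ?_))
  · rw [X.eNrm_const_mul hN0]
    finiteness
  · by_cases hx : x ∈ E N
    · rw [show chi (E N) x = 1 from indicator_of_mem hx _, abs_one]
      exact hx.2.trans (le_abs_self _)
    · rw [show chi (E N) x = 0 from indicator_of_notMem hx _, abs_zero]
      exact abs_nonneg _

/-- Finiteness spreads from one bounded set `E` of positive measure: if a cube `Q'` contains `Q ∪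
E`, then `M χ_E ≥ |E|/|Q'| > 0` on `Q`. -/
theorem MaximalRestrictedWeakType.eNrm_chi_ne_top (hX : X.MaximalRestrictedWeakType)
    {Q : Set (Fin n → ℝ)} (hQ : Q ∈ cubes n) : X.eNrm (chi Q) ≠ ∞ := by
  obtain ⟨C, hC⟩ := hX.eNrm_chi_le
  obtain ⟨E, hE, hEb, hE0, hEfin⟩ := X.exists_eNrm_chi_ne_top
  obtain ⟨Q', hQ', hsub⟩ := exists_cube_superset ((isBounded_of_mem_cubes hQ).union hEb)
  rw [union_subset_iff] at hsub
  have hv := volume_ne_top_of_mem_cubes hQ'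
  have hr : volume (Q' ∩ E) / volume Q' ≠ ∞ :=
    ENNReal.div_ne_top (ne_top_of_le_ne_top hv (measure_mono inter_subset_left))
      (volume_ne_zero_of_mem_cubes hQ')
  have h := hC E Q hE (measurableSet_of_mem_cubes hQ) _ hr fun x hx =>
    volume_inter_div_le_maximal hE hQ' (hsub.1 hx)
  intro htop
  rw [htop, ENNReal.mul_top, top_le_iff] at h
  · exact ENNReal.mul_ne_top ENNReal.coe_ne_top hEfin h
  · rw [inter_eq_self_of_subset_right hsub.2]
    exact ENNReal.div_ne_zero.2 ⟨hE0, hv⟩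

theorem MaximalRestrictedWeakType.volumeBound (hX : X.MaximalRestrictedWeakType) :
    ∃ C, X.VolumeBound C := by
  obtain ⟨C, hC⟩ := hX.eNrm_chi_le
  refine ⟨C, fun Q hQ E hEQ hE => ?_⟩
  have hv := volume_ne_top_of_mem_cubes hQ
  have hv0 := volume_ne_zero_of_mem_cubes hQ
  have hr : volume (Q ∩ E) / volume Q ≠ ∞ :=
    ENNReal.div_ne_top (ne_top_of_le_ne_top hv (measure_mono inter_subset_left)) hv0
  have h := hC E Q hE (measurableSet_of_mem_cubes hQ) _ hr fun x hx =>
    volume_inter_div_le_maximal hE hQ hx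
  rw [inter_eq_self_of_subset_right hEQ] at h
  calc volume E * X.eNrm (chi Q)
      = volume Q * (volume E / volume Q * X.eNrm (chi Q)) := by
        rw [← mul_assoc, ENNReal.mul_div_cancel hv0 hv]
    _ ≤ volume Q * (C * X.eNrm (chi E)) := by gcongr
    _ = _ := by ring

end RestrictedWeakType

end BanachFunctionSpace

end BMOSpaces

/-! ### The sparse inequality from `q`-concavity. -/

namespace BMOSpaces

theorem le_two_mul_of_le_add_half {S A : ℝ≥0∞} (hS : S ≠ ∞) (h : S ≤ A + 2⁻¹ * S) :
    S ≤ 2 * A := by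
  rcases eq_or_ne A ∞ with rfl | hA
  · simp
  lift S to ℝ≥0 using hS
  lift A to ℝ≥0 using hA
  have h2 : (2⁻¹ : ℝ≥0∞) = ((2⁻¹ : ℝ≥0) : ℝ≥0∞) := by simp
  rw [h2] at h
  norm_cast at h ⊢
  have h' : (S : ℝ) ≤ A + 2⁻¹ * S := by exact_mod_cast h
  have : (S : ℝ) ≤ 2 * A := by linarith
  exact_mod_cast this

/-- Shifting by `L` bounds a partial sum by `L * a 0` plus half of itself. Partial sums are finite,
so the half can be absorbed. -/
theorem tsum_le_of_antitone_of_half {a : ℕ → ℝ≥0∞} (ha : Antitone a) (h0 : a 0 ≠ ∞) {L : ℕ}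
    (hL : ∀ m, a (m + L) ≤ 2⁻¹ * a m) : ∑' k, a k ≤ 2 * (L * a 0) := by
  refine ENNReal.tsum_le_of_sum_range_le fun N => le_two_mul_of_le_add_half ?_ ?_
  · exact (ENNReal.sum_lt_top.2 fun k _ => (ha (Nat.zero_le k)).trans_lt h0.lt_top).ne
  · calc ∑ k ∈ Finset.range N, a k ≤ ∑ k ∈ Finset.range (L + N), a k :=
          Finset.sum_le_sum_of_subset (Finset.range_subset_range.2 (Nat.le_add_left _ _))
      _ = ∑ k ∈ Finset.range L, a k + ∑ k ∈ Finset.range N, a (L + k) :=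
          Finset.sum_range_add _ _ _
      _ ≤ L * a 0 + 2⁻¹ * ∑ k ∈ Finset.range N, a k := by
          gcongr
          · refine (Finset.sum_le_card_nsmul _ _ (a 0) fun k _ => ha (Nat.zero_le k)).trans ?_
            simp
          · rw [Finset.mul_sum]
            exact Finset.sum_le_sum fun k _ => by rw [add_comm]; exact hL k

namespace BanachFunctionSpace

variable {n : ℕ} {X : BanachFunctionSpace n}

/-- `q`-concavity applied to indicators of pairwise disjoint sets. -/
theorem eNrm_chi_le_of_concave {q : ℝ} (hq : 1 ≤ q) {C : ℝ≥0}
    (hC : ∀ (m : ℕ) (f : Fin m → X.carrier),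
      ENNReal.ofReal ((∑ k, X.nrm (f k) ^ q) ^ (1 / q)) ≤
        C * X.eNrm fun x => (∑ k, |(f k : L0 n) x| ^ q) ^ (1 / q))
    {L : ℕ} {E : Fin L → Set (Fin n → ℝ)} {A : Set (Fin n → ℝ)} (hEA : ∀ k, E k ⊆ A)
    (hdisj : Pairwise (Function.onFun Disjoint E)) (hA : X.eNrm (chi A) ≠ ∞)
    (hm : ∀ k, MeasurableSet (E k)) {s : ℝ≥0∞} (hs : ∀ k, s ≤ X.eNrm (chi (E k))) (hs' : s ≠ ∞) :
    ENNReal.ofReal ((L : ℝ) ^ (1 / q)) * s ≤ C * X.eNrm (chi A) := by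
  have hq0 : 0 < q := by linarith
  have hq1 : 0 < 1 / q := by positivity
  choose v hv using fun k => X.exists_of_eNrm_ne_top
    (ne_top_of_le_ne_top hA (eNrm_chi_mono (hm k) (hEA k)))
  have hsv : ∀ k, s.toReal ≤ X.nrm (v k) := fun k => by
    have := hs k
    rw [X.eNrm_eq_of_ae_eq (hv k)] at this
    exact ENNReal.toReal_le_of_le_ofReal (apply_nonneg _ _) this
  have hlow : (L : ℝ) ^ (1 / q) * s.toReal ≤ (∑ k, X.nrm (v k) ^ q) ^ (1 / q) := by
    calc (L : ℝ) ^ (1 / q) * s.toReal = (∑ _k : Fin L, s.toReal ^ q) ^ (1 / q) := by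
          rw [Finset.sum_const, Finset.card_univ, Fintype.card_fin, nsmul_eq_mul,
            Real.mul_rpow (Nat.cast_nonneg _) (by positivity),
            ← Real.rpow_mul ENNReal.toReal_nonneg, mul_one_div_cancel hq0.ne', Real.rpow_one]
      _ ≤ _ := by
          gcongr with k
          exact hsv k
  have hup : X.eNrm (fun x => (∑ k, |(v k : L0 n) x| ^ q) ^ (1 / q)) ≤ X.eNrm (chi A) := by
    refine X.eNrm_mono ?_ ?_
    · refine AEMeasurable.pow_const (Finset.aemeasurable_fun_sum _ fun k _ => ?_) _
      exact (AEEqFun.aemeasurable _).abs.pow_const _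
    · filter_upwards [ae_all_iff.2 hv] with x hx
      simp_rw [← hx]
      have hterm : ∀ k, |chi (E k) x| ^ q = chi (E k) x := fun k => by
        by_cases hxk : x ∈ E k
        · simp [chi, hxk]
        · simp [chi, hxk, Real.zero_rpow hq0.ne']
      simp_rw [hterm]
      by_cases hex : ∃ k, x ∈ E k
      · obtain ⟨k, hk⟩ := hex
        rw [Finset.sum_eq_single k]
        · simp [chi, hk, hEA k hk]
        · intro j _ hj
          exact indicator_of_notMem (Set.disjoint_right.1 (hdisj hj) hk) _
        · simp
      · push Not at hex
        have : ∑ k, chi (E k) x = 0 :=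
          Finset.sum_eq_zero fun k _ => indicator_of_notMem (hex k) _
        rw [this, Real.zero_rpow hq1.ne', abs_zero]
        exact abs_nonneg _
  calc ENNReal.ofReal ((L : ℝ) ^ (1 / q)) * s
      = ENNReal.ofReal ((L : ℝ) ^ (1 / q) * s.toReal) := by
        rw [ENNReal.ofReal_mul (by positivity), ENNReal.ofReal_toReal hs']
    _ ≤ ENNReal.ofReal ((∑ k, X.nrm (v k) ^ q) ^ (1 / q)) := ENNReal.ofReal_le_ofReal hlow
    _ ≤ _ := hC L v
    _ ≤ _ := by gcongr

/-- With `a k = ‖χ_{Ω_k}‖_X`, the differences `Ω_k \ Ω_{k+1}` have norm comparable to `a k`. Since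
`L` consecutive ones are disjoint, concavity gives `L^{1/q} a (m + L) ≲ a m`. For large `L` this is
decay by a factor `2`, and the `a k` are summable. -/
theorem MaximalRestrictedWeakType.sparseBound (hX : X.MaximalRestrictedWeakType) {q : ℝ}
    (hq : 1 ≤ q) (hconc : X.IsConcave q) : ∃ C, X.SparseBound C := by
  obtain ⟨C₁, hC₁⟩ := hX.eNrm_chi_le
  obtain ⟨C₂, hC₂⟩ := hconc
  have hq0 : 0 < q := by linarith
  -- The added `1` makes `D` nonzero, so that division by it is harmless.
  set D : ℝ≥0 := 2 * C₁ + 1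
  obtain ⟨L, hL⟩ := exists_nat_ge ((2 * D * C₂ + 1 : ℝ) ^ q)
  have hL' : (2 * D * C₂ + 1 : ℝ) ≤ (L : ℝ) ^ (1 / q) := by
    calc (2 * D * C₂ + 1 : ℝ) = ((2 * D * C₂ + 1 : ℝ) ^ q) ^ (1 / q) := by
          rw [← Real.rpow_mul (by positivity), mul_one_div_cancel hq0.ne', Real.rpow_one]
      _ ≤ _ := by gcongr
  have hLpos : 0 < (L : ℝ) ^ (1 / q) := lt_of_lt_of_le (by positivity) hL'
  have hD0 : (D : ℝ≥0∞) ≠ 0 := by simp [D]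
  refine ⟨2 * L, fun Q hQ F hF f hfm hf => ?_⟩
  set a : ℕ → ℝ≥0∞ := fun k => X.eNrm (chi (⋃₀ F k)) with ha
  have hmono : Antitone a := fun j k hjk => eNrm_chi_mono (hF.measurableSet k) (hF.antitone hjk)
  have ha0 : a 0 = X.eNrm (chi Q) := by simp only [ha, hF.sUnion_zero]
  have hfin : ∀ k, a k ≠ ∞ := fun k =>
    ne_top_of_le_ne_top (ha0 ▸ hX.eNrm_chi_ne_top hQ) (hmono (Nat.zero_le k))
  have hmE : ∀ k, MeasurableSet (⋃₀ F k \ ⋃₀ F (k + 1)) := fun k =>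
    (hF.measurableSet k).diff (hF.measurableSet (k + 1))
  have hdiff : ∀ k, a k ≤ D * X.eNrm (chi (⋃₀ F k \ ⋃₀ F (k + 1))) := by
    -- Half of every cube of layer `k` lies in the difference, so the maximal function of the
    -- difference is at least `1 / 2` on the whole layer.
    intro k
    have h := hC₁ _ (⋃₀ F k) (hmE k) (hF.measurableSet k) 2⁻¹ (by simp) ?_
    · calc a k = 2 * (2⁻¹ * a k) := by
            rw [← mul_assoc, ENNReal.mul_inv_cancel (by norm_num) (by norm_num), one_mul]
        _ ≤ 2 * (C₁ * X.eNrm (chi (⋃₀ F k \ ⋃₀ F (k + 1)))) := by gcongr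
        _ = ((2 * C₁ : ℝ≥0) : ℝ≥0∞) * X.eNrm (chi (⋃₀ F k \ ⋃₀ F (k + 1))) := by
            push_cast; ring
        _ ≤ _ := by gcongr; simp [D]
    · rintro x ⟨P, hP, hxP⟩
      have hPc := hF.subset_cubes k hP
      refine le_trans ?_ (volume_inter_div_le_maximal (hmE k) hPc hxP)
      have hsub : P \ ⋃₀ F (k + 1) ⊆ P ∩ (⋃₀ F k \ ⋃₀ F (k + 1)) := fun y hy =>
        ⟨hy.1, ⟨P, hP, hy.1⟩, hy.2⟩
      rw [ENNReal.le_div_iff_mul_le (Or.inl (volume_ne_zero_of_mem_cubes hPc))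
        (Or.inl (volume_ne_top_of_mem_cubes hPc)), mul_comm, ← div_eq_mul_inv]
      refine ENNReal.div_le_of_le_mul' ?_
      exact (hF.volume_diff k hP).trans (by gcongr)
  have hhalf : ∀ m, a (m + L) ≤ 2⁻¹ * a m := by
    intro m
    have h := eNrm_chi_le_of_concave (X := X) hq hC₂ (L := L)
      (E := fun k => ⋃₀ F (m + k) \ ⋃₀ F (m + k + 1)) (A := ⋃₀ F m)
      (s := a (m + L) / D)
      (fun k => sdiff_subset.trans (hF.antitone (Nat.le_add_right _ _)))
      ?_ (hfin m) (fun k => hmE _) (fun k => ?_) (ENNReal.div_ne_top (hfin _) hD0)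
    · have h1 : ENNReal.ofReal ((L : ℝ) ^ (1 / q)) * a (m + L) ≤ D * C₂ * a m := by
        calc ENNReal.ofReal ((L : ℝ) ^ (1 / q)) * a (m + L)
            = D * (ENNReal.ofReal ((L : ℝ) ^ (1 / q)) * (a (m + L) / D)) := by
              rw [mul_left_comm, ENNReal.mul_div_cancel hD0 ENNReal.coe_ne_top]
          _ ≤ D * (C₂ * a m) := by gcongr
          _ = _ := by ring
      have h2 : (D * C₂ : ℝ≥0∞) ≤ ENNReal.ofReal ((L : ℝ) ^ (1 / q)) * 2⁻¹ := by
        rw [← div_eq_mul_inv, ENNReal.le_div_iff_mul_le (by simp) (by simp)]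
        calc (D * C₂ : ℝ≥0∞) * 2 = ENNReal.ofReal (2 * D * C₂) := by
              rw [ENNReal.ofReal_mul (by positivity), ENNReal.ofReal_mul (by positivity)]
              simp only [ENNReal.ofReal_coe_nnreal, ENNReal.ofReal_ofNat]
              ring
          _ ≤ _ := ENNReal.ofReal_le_ofReal (by linarith)
      have h3 := h1.trans (mul_le_mul_left h2 (a m))
      rw [mul_assoc] at h3
      exact (ENNReal.mul_le_mul_iff_right (by simpa using hLpos) ENNReal.ofReal_ne_top).1 h3
    · have key : ∀ j k : Fin L, j < k → Disjoint (⋃₀ F (m + j) \ ⋃₀ F (m + j + 1))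
          (⋃₀ F (m + k) \ ⋃₀ F (m + k + 1)) := fun j k hjk =>
        Set.disjoint_left.2 fun x hx hx' => hx.2 (hF.antitone (by
          have : (j : ℕ) < k := hjk
          omega) hx'.1)
      exact (pairwise_disjoint_on _).2 key
    · refine ENNReal.div_le_of_le_mul' (le_trans (hmono ?_) (hdiff (m + k)))
      have := k.2
      omega
  -- Duality replaces the triangle inequality for the infinite sum of indicators.
  refine X.eNrm_le_of_forall_assoc hfm fun g hg => ?_
  calc ∫⁻ x, ‖f x‖ₑ * ‖g x‖ₑ ≤ ∑' k, ∫⁻ x in ⋃₀ F k, ‖g x‖ₑ :=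
        lintegral_tsum_indicator_mul_le hF hf (AEEqFun.aemeasurable g).enorm
    _ ≤ ∑' k, a k := by
        refine ENNReal.tsum_le_tsum fun k => ?_
        rw [← lintegral_chi_mul (hF.measurableSet k)]
        exact (X.lintegral_mul_le (hfin k) _).trans (mul_le_of_le_one_right' hg)
    _ ≤ 2 * (L * a 0) := tsum_le_of_antitone_of_half hmono (hfin 0) hhalf
    _ = _ := by rw [ha0]; push_cast; ring

end BanachFunctionSpace

end BMOSpaces

/-! ### Oscillation estimates and comparison of the seminorms. -/

namespace BMOSpaces

/-- Permits working with a positive number strictly above a seminorm that may vanish and whose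
infima need not be attained. -/
theorem le_mul_of_forall_lt_ofReal {a b : ℝ≥0∞} {K : ℝ≥0} (hb : b ≠ ∞)
    (h : ∀ s : ℝ, 0 < s → b < ENNReal.ofReal s → a ≤ K * ENNReal.ofReal s) : a ≤ K * b := by
  by_contra! hlt
  have hdiv : b < a / K := by
    rw [ENNReal.lt_div_iff_mul_lt (Or.inr hb) (Or.inl ENNReal.coe_ne_top), mul_comm]
    exact hlt
  obtain ⟨c, hbc, hca⟩ := exists_between hdiv
  have hc : c ≠ ∞ := hca.ne_top
  have hc0 : 0 < c.toReal := ENNReal.toReal_pos (ne_bot_of_gt hbc) hc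
  have := h c.toReal hc0 (by rwa [ENNReal.ofReal_toReal hc])
  rw [ENNReal.ofReal_toReal hc] at this
  exact hca.not_ge (ENNReal.div_le_of_le_mul' this)

theorem lintegral_enorm_sub_integral_le {α : Type*} [MeasurableSpace α] {ν : Measure α}
    [IsProbabilityMeasure ν] {f : α → ℝ} (hf : Integrable f ν) (c : ℝ) :
    ∫⁻ x, ‖f x - ∫ y, f y ∂ν‖ₑ ∂ν ≤ 2 * ∫⁻ x, ‖f x - c‖ₑ ∂ν := by
  have h1 : ‖c - ∫ y, f y ∂ν‖ₑ ≤ ∫⁻ x, ‖f x - c‖ₑ ∂ν := by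
    have : ∫ y, (f y - c) ∂ν = (∫ y, f y ∂ν) - c := by
      rw [integral_sub hf (integrable_const c), integral_const, probReal_univ, one_smul]
    rw [← enorm_neg, neg_sub, ← this]
    exact enorm_integral_le_lintegral_enorm _
  calc ∫⁻ x, ‖f x - ∫ y, f y ∂ν‖ₑ ∂ν
      ≤ ∫⁻ x, (‖f x - c‖ₑ + ‖c - ∫ y, f y ∂ν‖ₑ) ∂ν := by
        refine lintegral_mono fun x => ?_
        rw [← sub_add_sub_cancel (f x) c]
        exact enorm_add_le _ _
    _ = ∫⁻ x, ‖f x - c‖ₑ ∂ν + ‖c - ∫ y, f y ∂ν‖ₑ := by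
        rw [lintegral_add_right _ measurable_const, lintegral_const, measure_univ, mul_one]
    _ ≤ 2 * ∫⁻ x, ‖f x - c‖ₑ ∂ν := by
        rw [two_mul]
        gcongr

section Oscillation

variable {n : ℕ} {f : (Fin n → ℝ) → ℝ}

theorem laverage_sub_average_le {Q : Set (Fin n → ℝ)} (hQ : Q ∈ cubes n)
    (hf : IntegrableOn f Q volume) (c : ℝ) :
    ⨍⁻ x in Q, ‖f x - ⨍ y in Q, f y ∂volume‖ₑ ∂volume ≤ 2 * ⨍⁻ x in Q, ‖f x - c‖ₑ ∂volume := by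
  have h0 := volume_ne_zero_of_mem_cubes hQ
  have : IsFiniteMeasure (volume.restrict Q : Measure (Fin n → ℝ)) :=
    ⟨by rw [Measure.restrict_apply_univ]; exact (volume_ne_top_of_mem_cubes hQ).lt_top⟩
  have : NeZero (volume.restrict Q : Measure (Fin n → ℝ)) :=
    ⟨by rwa [Ne, Measure.restrict_eq_zero]⟩
  exact lintegral_enorm_sub_integral_le (hf.smul_measure (by simp [h0])) c

/-- The John-Strömberg theorem. -/
theorem locallyIntegrable_and_bmoNrm_le (hf : AEMeasurable f volume)
    {c : Set (Fin n → ℝ) → ℝ} {t : ℝ} (ht : 0 ≤ t)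
    (hosc : ∀ P ∈ cubes n, 2 ^ (n + 2) * volume {x ∈ P | t < |f x - c P|} ≤ volume P) :
    LocallyIntegrable f volume ∧ bmoNrm f ≤ 8 * ENNReal.ofReal t := by
  -- Integrating the sparse domination gives `2 * t` times the total layer volume, which is at most
  -- `2 * volume Q`. Replacing `c Q` by the mean later doubles the constant to `8`.
  have hint : ∀ Q ∈ cubes n, ∫⁻ x in Q, ‖f x - c Q‖ₑ ≤ 4 * ENNReal.ofReal t * volume Q := by
    intro Q hQ
    obtain ⟨F, hF, hdom⟩ := exists_sparse_domination ht hosc hQ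
    have hm := measurableSet_of_mem_cubes hQ
    have hmi : ∀ k, Measurable ((⋃₀ F k).indicator (1 : (Fin n → ℝ) → ℝ≥0∞)) := fun k =>
      measurable_one.indicator (hF.measurableSet k)
    calc ∫⁻ x in Q, ‖f x - c Q‖ₑ
        ≤ ∫⁻ x in Q, ENNReal.ofReal (2 * t) * ∑' k, (⋃₀ F k).indicator 1 x :=
          setLIntegral_mono_ae' hm hdom
      _ ≤ ∫⁻ x, ENNReal.ofReal (2 * t) * ∑' k, (⋃₀ F k).indicator 1 x :=
          setLIntegral_le_lintegral _ _
      _ = ENNReal.ofReal (2 * t) * ∑' k, volume (⋃₀ F k) := by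
          rw [lintegral_const_mul' _ _ ENNReal.ofReal_ne_top,
            lintegral_tsum fun k => (hmi k).aemeasurable]
          simp_rw [lintegral_indicator_one (hF.measurableSet _)]
      _ ≤ ENNReal.ofReal (2 * t) * (2 * volume Q) := by
          gcongr
          exact hF.tsum_volume_le
      _ = _ := by
          rw [ENNReal.ofReal_mul (by norm_num), ENNReal.ofReal_ofNat]
          ring
  have hintQ : ∀ Q ∈ cubes n, IntegrableOn f Q volume := by
    intro Q hQ
    have hv := volume_ne_top_of_mem_cubes hQ
    have h1 : IntegrableOn (fun x => f x - c Q) Q volume :=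
      ⟨(hf.sub_const _).aestronglyMeasurable.restrict,
        (hint Q hQ).trans_lt (by finiteness)⟩
    have h2 : IntegrableOn (fun _ : Fin n → ℝ => c Q) Q volume := integrableOn_const hv
    refine (h1.add h2).congr_fun_ae (Eventually.of_forall fun x => ?_)
    exact sub_add_cancel _ _
  refine ⟨fun x => ?_, iSup₂_le fun Q hQ => ?_⟩
  · obtain ⟨Q, hQ, hsub⟩ := exists_cube_superset (Metric.isBounded_ball (x := x) (r := 1))
    exact ⟨Q, mem_of_superset (Metric.ball_mem_nhds x one_pos) hsub, hintQ Q hQ⟩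
  · refine (laverage_sub_average_le hQ (hintQ Q hQ) (c Q)).trans ?_
    rw [setLAverage_eq]
    calc 2 * ((∫⁻ x in Q, ‖f x - c Q‖ₑ) / volume Q)
        ≤ 2 * (4 * ENNReal.ofReal t) := by
          gcongr
          exact ENNReal.div_le_of_le_mul (hint Q hQ)
      _ = _ := by ring

end Oscillation

namespace BanachFunctionSpace

variable {n : ℕ} {X : BanachFunctionSpace n} {f : (Fin n → ℝ) → ℝ}

theorem eNrm_chi_mul_le (X : BanachFunctionSpace n) {Q E : Set (Fin n → ℝ)} {c t : ℝ}
    (ht : 0 < t) (hE : MeasurableSet E) (hEsub : E ⊆ {x ∈ Q | t < |f x - c|}) :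
    ENNReal.ofReal t * X.eNrm (chi E) ≤ X.eNrm (Q.indicator fun x => f x - c) := by
  rw [← Real.enorm_eq_ofReal ht.le, ← X.eNrm_const_mul ht.ne']
  refine X.eNrm_mono ((measurable_chi hE).aemeasurable.const_mul t)
    (Eventually.of_forall fun x => ?_)
  by_cases hx : x ∈ E
  · obtain ⟨hxQ, hxt⟩ := hEsub hx
    rw [show chi E x = 1 from indicator_of_mem hx _, indicator_of_mem hxQ, mul_one, abs_of_pos ht]
    exact hxt.le
  · rw [show chi E x = 0 from indicator_of_notMem hx _, mul_zero, abs_zero]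
    exact abs_nonneg _

/-- Chebyshev's inequality in `X` bounds the relative norm of `{|f - c| > t}`, `VolumeBound`
converts this into relative volume, and the John-Strömberg theorem applies. Local integrability is a
conclusion here. -/
theorem VolumeBound.bmoNrm_le {C : ℝ≥0} (hC : X.VolumeBound C)
    (hfin : ∀ Q ∈ cubes n, X.eNrm (chi Q) ≠ 0 ∧ X.eNrm (chi Q) ≠ ∞)
    (hf : AEMeasurable f volume) (hstar : X.bmoStarNrm f ≠ ∞) :
    LocallyIntegrable f volume ∧
      BMOSpaces.bmoNrm f ≤ (8 * (2 ^ (n + 2) * (C + 1)) : ℝ≥0) * X.bmoStarNrm f := by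
  have key : ∀ s : ℝ, 0 < s → X.bmoStarNrm f < ENNReal.ofReal s →
      LocallyIntegrable f volume ∧
        BMOSpaces.bmoNrm f ≤ (8 * (2 ^ (n + 2) * (C + 1)) : ℝ≥0) * ENNReal.ofReal s := by
    intro s hs hlt
    have hex : ∀ Q, ∃ c : ℝ, Q ∈ cubes n → X.localENrm Q (fun x => f x - c) < ENNReal.ofReal s := by
      intro Q
      by_cases hQ : Q ∈ cubes n
      · have h1 : ⨅ c : ℝ, X.localENrm Q (fun x => f x - c) < ENNReal.ofReal s :=
          (le_iSup₂ (f := fun Q (_ : Q ∈ cubes n) => ⨅ c : ℝ, X.localENrm Q fun x => f x - c)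
            Q hQ).trans_lt hlt
        obtain ⟨c, hc⟩ := iInf_lt_iff.1 h1
        exact ⟨c, fun _ => hc⟩
      · exact ⟨0, fun h => absurd h hQ⟩
    choose c hc using hex
    -- Chosen so that `C * s / t ≤ 2 ^ (-(n + 2))`; `C + 1` keeps `t` positive even if `C = 0`.
    set t : ℝ := 2 ^ (n + 2) * (C + 1) * s with ht
    have ht0 : 0 < t := by positivity
    have hosc : ∀ P ∈ cubes n, 2 ^ (n + 2) * volume {x ∈ P | t < |f x - c P|} ≤ volume P := by
      intro Q hQ
      obtain ⟨h0, htop⟩ := hfin Q hQ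
      have hnull : NullMeasurableSet {x ∈ Q | t < |f x - c Q|} volume :=
        (measurableSet_of_mem_cubes hQ).nullMeasurableSet.inter
          (nullMeasurableSet_lt aemeasurable_const (hf.sub_const _).abs)
      -- `f` is only a.e. measurable, while `VolumeBound` speaks of measurable sets.
      obtain ⟨E, hEsub, hE, hEeq⟩ := hnull.exists_measurable_subset_ae_eq
      rw [← measure_congr hEeq]
      have h1 := X.eNrm_chi_mul_le ht0 hE hEsub
      have h2 := (hc Q hQ).le
      rw [localENrm, ENNReal.div_le_iff h0 htop] at h2
      have h3 := hC Q hQ E (hEsub.trans (sep_subset _ _)) hE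
      have h4 : ENNReal.ofReal t * volume E * X.eNrm (chi Q) ≤
          (C + 1) * ENNReal.ofReal s * volume Q * X.eNrm (chi Q) :=
        calc ENNReal.ofReal t * volume E * X.eNrm (chi Q)
            = ENNReal.ofReal t * (volume E * X.eNrm (chi Q)) := by ring
          _ ≤ ENNReal.ofReal t * (C * (volume Q * X.eNrm (chi E))) := by gcongr
          _ = C * volume Q * (ENNReal.ofReal t * X.eNrm (chi E)) := by ring
          _ ≤ C * volume Q * (ENNReal.ofReal s * X.eNrm (chi Q)) := by
              exact mul_le_mul_right (h1.trans h2) _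
          _ = C * ENNReal.ofReal s * volume Q * X.eNrm (chi Q) := by ring
          _ ≤ _ := by
              gcongr
              exact le_self_add
      have h5 := (ENNReal.mul_le_mul_iff_left h0 htop).1 h4
      have h6 : ENNReal.ofReal t = 2 ^ (n + 2) * ((C + 1) * ENNReal.ofReal s) := by
        rw [ht, ENNReal.ofReal_mul (by positivity), ENNReal.ofReal_mul (by positivity),
          ENNReal.ofReal_pow (by norm_num), ENNReal.ofReal_add (by positivity) (by norm_num)]
        simp only [ENNReal.ofReal_coe_nnreal, ENNReal.ofReal_ofNat, ENNReal.ofReal_one]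
        ring
      rw [h6, mul_right_comm, mul_comm] at h5
      refine (ENNReal.mul_le_mul_iff_right (a := (C + 1) * ENNReal.ofReal s) ?_ ?_).1 h5
      · simpa using hs
      · finiteness
    obtain ⟨hloc, hle⟩ := locallyIntegrable_and_bmoNrm_le hf ht0.le hosc
    refine ⟨hloc, hle.trans (le_of_eq ?_)⟩
    rw [ht, ENNReal.ofReal_mul (by positivity), ENNReal.ofReal_mul (by positivity),
      ENNReal.ofReal_pow (by norm_num), ENNReal.ofReal_add (by positivity) (by norm_num)]
    simp only [ENNReal.ofReal_coe_nnreal, ENNReal.ofReal_ofNat, ENNReal.ofReal_one]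
    push_cast
    ring
  refine ⟨?_, le_mul_of_forall_lt_ofReal hstar fun s hs hlt => (key s hs hlt).2⟩
  have hpos : 0 < (X.bmoStarNrm f).toReal + 1 := by positivity
  refine (key _ hpos ?_).1
  rw [ENNReal.ofReal_add ENNReal.toReal_nonneg zero_le_one, ENNReal.ofReal_toReal hstar]
  exact ENNReal.lt_add_right hstar (by simp)

/-- The classical Chebyshev inequality at height `2 ^ (n + 2) * s` gives the smallness needed for
sparse domination with the means as constants. -/
theorem SparseBound.bmoNrm_le {C : ℝ≥0} (hC : X.SparseBound C) (hf : LocallyIntegrable f volume)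
    (hbmo : BMOSpaces.bmoNrm f ≠ ∞) :
    X.bmoNrm f ≤ (2 * 2 ^ (n + 2) * C : ℝ≥0) * BMOSpaces.bmoNrm f := by
  refine le_mul_of_forall_lt_ofReal hbmo fun s hs hlt => iSup₂_le fun Q hQ => ?_
  have hfm : AEMeasurable f volume := hf.aestronglyMeasurable.aemeasurable
  set t : ℝ := 2 ^ (n + 2) * s with ht
  have ht0 : 0 < t := by positivity
  have ht' : ENNReal.ofReal t = 2 ^ (n + 2) * ENNReal.ofReal s := by
    rw [ht, ENNReal.ofReal_mul (by positivity), ENNReal.ofReal_pow (by norm_num),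
      ENNReal.ofReal_ofNat]
  have hosc : ∀ P ∈ cubes n,
      2 ^ (n + 2) * volume {x ∈ P | t < |f x - ⨍ y in P, f y ∂volume|} ≤ volume P := by
    intro P hP
    have hm := measurableSet_of_mem_cubes hP
    have hle : ⨍⁻ x in P, ‖f x - ⨍ y in P, f y ∂volume‖ₑ ∂volume ≤ ENNReal.ofReal s :=
      (le_iSup₂ (f := fun P (_ : P ∈ cubes n) =>
        ⨍⁻ x in P, ‖f x - ⨍ y in P, f y ∂volume‖ₑ ∂volume) P hP).trans hlt.le
    rw [setLAverage_eq, ENNReal.div_le_iff (volume_ne_zero_of_mem_cubes hP)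
      (volume_ne_top_of_mem_cubes hP)] at hle
    have hcheb := mul_meas_ge_le_lintegral₀ (μ := volume.restrict P)
      (f := fun x => ‖f x - ⨍ y in P, f y ∂volume‖ₑ) (hfm.sub_const _).enorm.restrict
      (ENNReal.ofReal t)
    rw [Measure.restrict_apply' hm] at hcheb
    have hsub : {x ∈ P | t < |f x - ⨍ y in P, f y ∂volume|} ⊆
        {x | ENNReal.ofReal t ≤ ‖f x - ⨍ y in P, f y ∂volume‖ₑ} ∩ P := fun x hx => by
      refine ⟨?_, hx.1⟩
      show ENNReal.ofReal t ≤ ‖f x - ⨍ y in P, f y ∂volume‖ₑ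
      rw [← Real.enorm_abs, Real.enorm_eq_ofReal (abs_nonneg _)]
      exact ENNReal.ofReal_le_ofReal hx.2.le
    have h1 : ENNReal.ofReal t * volume {x ∈ P | t < |f x - ⨍ y in P, f y ∂volume|} ≤
        ENNReal.ofReal s * volume P :=
      le_trans (by gcongr) (hcheb.trans hle)
    rw [ht', mul_right_comm, mul_comm] at h1
    exact (ENNReal.mul_le_mul_iff_right (by simpa using hs) ENNReal.ofReal_ne_top).1 h1
  obtain ⟨F, hF, hdom⟩ := exists_sparse_domination ht0.le hosc hQ
  set φ : (Fin n → ℝ) → ℝ := Q.indicator fun x => f x - ⨍ y in Q, f y ∂volume with hφ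
  have hφm : AEMeasurable φ volume :=
    (hfm.sub_const _).indicator (measurableSet_of_mem_cubes hQ)
  have h2t : (2 * t) ≠ 0 := by positivity
  -- `SparseBound` is normalised to coefficient one, so `φ` is divided by `2 * t` and rescaled
  -- afterwards.
  have hsp := hC Q hQ F hF (fun x => (2 * t)⁻¹ * φ x) (hφm.const_mul _) (by
    filter_upwards [hdom] with x hx
    by_cases hxQ : x ∈ Q
    · rw [hφ, indicator_of_mem hxQ, enorm_mul]
      calc _ ≤ ‖(2 * t)⁻¹‖ₑ * (ENNReal.ofReal (2 * t) * ∑' k, (⋃₀ F k).indicator 1 x) := by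
            gcongr
            exact hx hxQ
        _ = _ := by
            rw [← mul_assoc, ← Real.enorm_eq_ofReal (by positivity), ← enorm_mul,
              inv_mul_cancel₀ h2t, enorm_one, one_mul]
    · rw [hφ, indicator_of_notMem hxQ, mul_zero, enorm_zero]
      exact zero_le)
  have hφC : X.eNrm φ ≤ ENNReal.ofReal (2 * t) * (C * X.eNrm (chi Q)) := by
    have h := X.eNrm_const_mul h2t fun x => (2 * t)⁻¹ * φ x
    simp only [mul_inv_cancel_left₀ h2t] at h
    rw [h, Real.enorm_eq_ofReal (by positivity)]
    gcongr
  refine ENNReal.div_le_of_le_mul (hφC.trans (le_of_eq ?_))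
  rw [ENNReal.ofReal_mul (by norm_num), ht', ENNReal.ofReal_ofNat]
  push_cast
  ring

theorem bmoStarNrm_le_bmoNrm (X : BanachFunctionSpace n) (f : (Fin n → ℝ) → ℝ) :
    X.bmoStarNrm f ≤ X.bmoNrm f :=
  iSup₂_mono fun _ _ => iInf_le _ _

end BanachFunctionSpace

end BMOSpaces

/-! ### The cycle of inclusions and the common constant. -/

theorem mainTheorem7 (n : ℕ) (X : BMOSpaces.BanachFunctionSpace n)
    (hX : X.MaximalBoundedOnAssociate ∨
      ((∃ q : ℝ, 1 ≤ q ∧ X.IsConcave q) ∧ X.MaximalRestrictedWeakType)) :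
    (∀ Q ∈ BMOSpaces.cubes n, X.eNrm (BMOSpaces.chi Q) ≠ 0 ∧ X.eNrm (BMOSpaces.chi Q) ≠ ∞) ∧
    BMOSpaces.BMO n = X.BMO ∧ X.BMO = X.BMOStar ∧
    ∃ C : ℝ≥0, ∀ f ∈ BMOSpaces.BMO n,
      X.bmoNrm f ≤ C * BMOSpaces.bmoNrm f ∧
      BMOSpaces.bmoNrm f ≤ C * X.bmoStarNrm f ∧
      X.bmoStarNrm f ≤ C * X.bmoNrm f := by
  obtain ⟨hfin, ⟨A, hA⟩, ⟨B, hB⟩⟩ : (∀ Q ∈ BMOSpaces.cubes n, X.eNrm (BMOSpaces.chi Q) ≠ ∞) ∧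
      (∃ A, X.VolumeBound A) ∧ ∃ B, X.SparseBound B := by
    rcases hX with h | ⟨⟨q, hq, hc⟩, h⟩
    · exact ⟨fun Q hQ => h.eNrm_chi_ne_top hQ, h.volumeBound, h.sparseBound⟩
    · exact ⟨fun Q hQ => h.eNrm_chi_ne_top hQ, h.volumeBound, h.sparseBound hq hc⟩
  have hchi : ∀ Q ∈ BMOSpaces.cubes n,
      X.eNrm (BMOSpaces.chi Q) ≠ 0 ∧ X.eNrm (BMOSpaces.chi Q) ≠ ∞ := fun Q hQ =>
    ⟨BMOSpaces.BanachFunctionSpace.eNrm_chi_ne_zero (BMOSpaces.volume_ne_zero_of_mem_cubes hQ),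
      hfin Q hQ⟩
  have h1 : BMOSpaces.BMO n ⊆ X.BMO := fun f hf =>
    ⟨hf.1, (hB.bmoNrm_le hf.1 hf.2.ne).trans_lt (ENNReal.mul_lt_top ENNReal.coe_lt_top hf.2)⟩
  have h2 : X.BMO ⊆ X.BMOStar := fun f hf =>
    ⟨hf.1.aestronglyMeasurable.aemeasurable, (X.bmoStarNrm_le_bmoNrm f).trans_lt hf.2⟩
  have h3 : X.BMOStar ⊆ BMOSpaces.BMO n := fun f hf =>
    ⟨(hA.bmoNrm_le hchi hf.1 hf.2.ne).1,
      (hA.bmoNrm_le hchi hf.1 hf.2.ne).2.trans_lt (ENNReal.mul_lt_top ENNReal.coe_lt_top hf.2)⟩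
  refine ⟨hchi, h1.antisymm (h2.trans h3), h2.antisymm (h3.trans h1),
    2 * 2 ^ (n + 2) * B + 8 * (2 ^ (n + 2) * (A + 1)) + 1, fun f hf => ⟨?_, ?_, ?_⟩⟩
  · refine (hB.bmoNrm_le hf.1 hf.2.ne).trans ?_
    gcongr
    rw [add_assoc]
    exact le_self_add
  · have hs := h2 (h1 hf)
    refine (hA.bmoNrm_le hchi hs.1 hs.2.ne).2.trans ?_
    gcongr
    exact le_add_self.trans le_self_add
  · refine (X.bmoStarNrm_le_bmoNrm f).trans (le_mul_of_one_le_left zero_le ?_)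
    exact_mod_cast le_add_self
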